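/- Let $p$ be a prime, $n\ge 1$ and $q=p^n$. On $(\mathbb{C}^p)^{\otimes n}$ let $X_j$ and $Z_j$ be the cyclic shift $|u\rangle\mapsto|u+1\rangle$ and the phase operator $|u\rangle\mapsto e^{2\pi \mathrm{i}u/p}|u\rangle$ ($u\in\mathbb{F}_p$) of the $j$th factor. For $\mu\in\mathbb{F}_p^{2n}$ let $D_\mu=\tau^{\sum_j\mu_j\mu_{n+j}}\prod_{j=1}^n X_j^{\mu_j}Z_j^{\mu_{n+j}}$ with $\tau=-e^{\pi \mathrm{i}/p}$ be the displacement operators (exponents are represented by integers in $\{0,\dots,p-1\}$). The Clifford group $\mathrm{C}$ in dimension $q$ is the group of all unitary operators $U$ that map displacement operators to displacement operators up to phase factors, that is, for every $\mu$ there is a $\nu$ with $UD_\mu U^\dagger\propto D_\nu$. Let $\mathrm{Sp}(2n,p)$ be the group of linear maps of $\mathbb{F}_p^{2n}$ preserving the symplectic product $\langle\mu,\nu\rangle=\sum_j(\mu_{n+j}\nu_j-\mu_j\nu_{n+j})$. Identify $\mathbb{F}_p^{2n}$ with $\mathbb{F}_q^2$ by any $\mathbb{F}_p$-linear isomorphism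 that carries $\mathrm{SL}(2,q)$ into $\mathrm{Sp}(2n,p)$. The restricted Clifford group $\mathrm{C}_{\mathrm r}$ is the subgroup of those $U\in\mathrm{C}$ for which there is an $F\in\mathrm{SL}(2,q)$ with $UD_\mu U^\dagger\propto D_{F\mu}$ for all $\mu$. A finite family $U_1,\dots,U_K$ of unitary operators on $\mathbb{C}^d$ is a unitary $t$-design if $$\frac1K\sum_{s}U_s^{\otimes t}A(U_s^{\otimes t})^\dagger=\int \mathrm{d}U\,U^{\otimes t}A(U^{\otimes t})^\dagger$$ for every operator $A$ on $(\mathbb{C}^d)^{\otimes t}$, where the integral is over the whole unitary group with respect to the normalized Haar measure. A group $G$ of unitary operators is called a unitary $t$-design if its quotient $\overline{G}$ by the phase factors is finite and is a unitary $t$-design (each element of $\overline G$ being represented by any operator in its class). **Theorem.** (1) For every $n\ge1$ the multiqubit Clifford group (dimension $2^n$) is a unitary 3-design but not a unitary 4-design. (2) The Clifford group in any odd prime power dimension is a unitary 2-design but not a unitary 3-design. (3) The restricted Clifford group in any prime power dimension $q$ is a unitary 2-design, and it is a unitary 3-design if and only if $q=2$. -/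

import Mathlib

open Matrix MeasureTheory

noncomputable section

namespace CliffordDesign

/-! ### Unitary designs -/

section Designs

variable {d : Type*} [Fintype d] [DecidableEq d]

instance instCompactSpaceUnitaryGroup : CompactSpace (unitaryGroup d ℂ) := by
  rw [← isCompact_univ_iff, Topology.IsEmbedding.subtypeVal.isCompact_iff, Set.image_univ,
    Subtype.range_coe_subtype]
  have hK : IsCompact (Set.univ.pi fun _ : d => Set.univ.pi fun _ : d =>
      Metric.closedBall (0 : ℂ) 1) :=
    isCompact_univ_pi fun _ => isCompact_univ_pi fun _ => isCompact_closedBall 0 1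
  have hc : IsClosed ({U | U ∈ unitaryGroup d ℂ} : Set (Matrix d d ℂ)) := isClosed_unitary
  refine IsCompact.of_isClosed_subset (X := Matrix d d ℂ) hK hc ?_
  intro U hU i _ j _
  simpa using entry_norm_bound_of_unitary hU i j

instance instMeasurableSpaceUnitaryGroup : MeasurableSpace (unitaryGroup d ℂ) := borel _

instance instBorelSpaceUnitaryGroup : BorelSpace (unitaryGroup d ℂ) := ⟨rfl⟩

/-- The normalized Haar measure on the group of all unitary matrices. -/
def haarUnitary (d : Type*) [Fintype d] [DecidableEq d] : Measure (unitaryGroup d ℂ) :=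
  Measure.haarMeasure ⊤

/-- The `t`-fold tensor power `U^{⊗ t}`, as a matrix indexed by `t`-tuples. -/
def tensorPow (t : ℕ) (U : Matrix d d ℂ) : Matrix (Fin t → d) (Fin t → d) ℂ :=
  Matrix.of fun i j => ∏ k, U (i k) (j k)

/-- A finite family of unitary matrices is a unitary `t`-design if
`(1 / K) ∑ₛ Uₛ^{⊗ t} A (Uₛ^{⊗ t})† = ∫ U^{⊗ t} A (U^{⊗ t})† dU` for every operator `A` on the
`t`-partite space, the integral being over the normalized Haar measure of the unitary group.
The equality of matrices is spelled out entry by entry. -/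
def IsUnitaryDesign {ι : Type*} [Fintype ι] (t : ℕ) (U : ι → unitaryGroup d ℂ) : Prop :=
  ∀ (A : Matrix (Fin t → d) (Fin t → d) ℂ) (i j : Fin t → d),
    (Fintype.card ι : ℂ)⁻¹ *
        ∑ s, (tensorPow t (U s : Matrix d d ℂ) * A * (tensorPow t (U s : Matrix d d ℂ))ᴴ) i j =
      ∫ V : unitaryGroup d ℂ,
        (tensorPow t (V : Matrix d d ℂ) * A * (tensorPow t (V : Matrix d d ℂ))ᴴ) i j
          ∂(haarUnitary d)

/-- The group of phase factors: the unitary scalar matrices. -/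
def phases (d : Type*) [Fintype d] [DecidableEq d] : Subgroup (unitaryGroup d ℂ) where
  carrier := {U | ∃ c : ℂ, ‖c‖ = 1 ∧ (U : Matrix d d ℂ) = c • (1 : Matrix d d ℂ)}
  one_mem' := ⟨1, by simp, by simp⟩
  mul_mem' := by
    rintro U V ⟨c, hc, hU⟩ ⟨e, he, hV⟩
    exact ⟨c * e, by simp [hc, he], by simp [hU, hV, smul_smul, mul_comm]⟩
  inv_mem' := by
    rintro U ⟨c, hc, hU⟩
    refine ⟨star c, by simpa using hc, ?_⟩
    rw [← Unitary.star_eq_inv, Unitary.coe_star, hU]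
    simp

/-- A group `G` of unitary matrices is a (projective) unitary `t`-design if its quotient by the
phase factors is finite and is a unitary `t`-design; each element of the quotient is
represented by a unitary matrix in `G`, and the choice of the representatives is immaterial
because `U^{⊗ t} A (U^{⊗ t})†` does not change when `U` is multiplied by a phase. -/
def IsGroupDesign (t : ℕ) (G : Subgroup (unitaryGroup d ℂ)) : Prop :=
  ∃ _ : Fintype (G ⧸ (phases d).subgroupOf G),
    IsUnitaryDesign t fun x : G ⧸ (phases d).subgroupOf G => (x.out : unitaryGroup d ℂ)

end Designs

/-! ### Displacement operators -/

section Weyl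

variable (p : ℕ)

/-- The primitive root of unity `ω = e^{2πi/p}`. -/
def omega : ℂ := Complex.exp (2 * Real.pi * Complex.I / p)

/-- The phase `τ = -e^{πi/p}`. -/
def tau : ℂ := -Complex.exp (Real.pi * Complex.I / p)

theorem tau_ne_zero {p : ℕ} : tau p ≠ 0 := neg_ne_zero.2 (Complex.exp_ne_zero _)

variable [Fact p.Prime]

/-- The phase operator, `Z |u⟩ = ω^u |u⟩`. -/
def clockZ : Matrix (ZMod p) (ZMod p) ℂ := Matrix.diagonal fun u => omega p ^ u.val

/-- The cyclic shift operator, `X |u⟩ = |u + 1⟩`. -/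
def shiftX : Matrix (ZMod p) (ZMod p) ℂ := Matrix.of fun v u => if v = u + 1 then 1 else 0

/-- The symplectic space `𝔽_p^{2n}`; a vector is written as the pair of its halves
`(μ_1, …, μ_n)` and `(μ_{n+1}, …, μ_{2n})`. -/
abbrev PhaseSpace (p n : ℕ) : Type := (Fin n → ZMod p) × (Fin n → ZMod p)

/-- The symplectic product `μᵀ J ν` with `J = (0, -1; 1, 0)`. -/
def sympl {p n : ℕ} (μ ν : PhaseSpace p n) : ZMod p :=
  ∑ j, (μ.2 j * ν.1 j - μ.1 j * ν.2 j)

variable {p} {n : ℕ}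

/-- The displacement operator `D_μ = τ^{∑ μ_j μ_{n+j}} ∏ X_j^{μ_j} Z_j^{μ_{n+j}}` on `n` copies
of `ℂ^p`, that is, the tensor product over `j` of the operators `X^{μ_j} Z^{μ_{n+j}}`, times a
phase. -/
def displacement (μ : PhaseSpace p n) : Matrix (Fin n → ZMod p) (Fin n → ZMod p) ℂ :=
  tau p ^ (∑ j, (μ.1 j).val * (μ.2 j).val) •
    Matrix.of fun u v =>
      ∏ j, (shiftX p ^ (μ.1 j).val * clockZ p ^ (μ.2 j).val : Matrix (ZMod p) (ZMod p) ℂ)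
        (u j) (v j)

theorem omega_primitive : IsPrimitiveRoot (omega p) p :=
  Complex.isPrimitiveRoot_exp p (Fact.out : p.Prime).ne_zero

theorem shiftX_pow (k : ℕ) :
    shiftX p ^ k = Matrix.of fun v u : ZMod p => if v = u + (k : ZMod p) then (1 : ℂ) else 0 := by
  induction k with
  | zero => ext v u; simp [Matrix.one_apply]
  | succ k ih =>
    ext v u
    rw [pow_succ, ih]
    simp only [Matrix.mul_apply, Matrix.of_apply, shiftX, mul_ite, mul_one, mul_zero]
    simp only [Finset.sum_ite_eq', Finset.mem_univ, if_true]
    congr 1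
    push_cast
    rw [add_assoc, add_comm (1 : ZMod p)]

/-- The matrix entries of a displacement operator. -/
theorem displacement_apply (μ : PhaseSpace p n) (u v : Fin n → ZMod p) :
    displacement μ u v = tau p ^ (∑ j, (μ.1 j).val * (μ.2 j).val) *
      ∏ j, if u j = v j + μ.1 j then omega p ^ ((v j).val * (μ.2 j).val) else 0 := by
  simp only [displacement, Matrix.smul_apply, Matrix.of_apply, smul_eq_mul]
  congr 1
  refine Finset.prod_congr rfl fun j _ => ?_
  rw [shiftX_pow, clockZ, Matrix.diagonal_pow, Matrix.mul_diagonal]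
  simp [pow_mul]

theorem displacement_apply_ne_zero_iff (μ : PhaseSpace p n) (u v : Fin n → ZMod p) :
    displacement μ u v ≠ 0 ↔ u = v + μ.1 := by
  have hω : omega p ≠ 0 := omega_primitive.ne_zero (Fact.out : p.Prime).ne_zero
  rw [displacement_apply, mul_ne_zero_iff, Finset.prod_ne_zero_iff]
  constructor
  · rintro ⟨-, h⟩
    funext j
    by_contra hj
    exact h j (Finset.mem_univ _) (if_neg hj)
  · rintro rfl
    exact ⟨pow_ne_zero _ tau_ne_zero, fun j _ => by simp [hω]⟩

/-- Displacement operators with different labels are not proportional to each other. -/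
theorem eq_of_displacement_eq_smul {μ ν : PhaseSpace p n} {c : ℂ}
    (h : displacement μ = c • displacement ν) : μ = ν := by
  have hω : omega p ≠ 0 := omega_primitive.ne_zero (Fact.out : p.Prime).ne_zero
  have hE : ∀ u v, displacement μ u v = c * displacement ν u v := fun u v => by
    rw [h]; simp
  have h1 : μ.1 = ν.1 := by
    have h0 : displacement μ μ.1 0 ≠ 0 := by
      rw [displacement_apply_ne_zero_iff, zero_add]
    rw [hE] at h0
    have := (displacement_apply_ne_zero_iff ν μ.1 0).1 (right_ne_zero_of_mul h0)
    simpa using this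
  have h0 := hE μ.1 0
  rw [displacement_apply, displacement_apply, ← h1] at h0
  simp only [Pi.zero_apply, zero_add, if_true, ZMod.val_zero, zero_mul, pow_zero,
    Finset.prod_const_one, mul_one] at h0
  refine Prod.ext h1 (funext fun k => ?_)
  have hk := hE (Pi.single k 1 + μ.1) (Pi.single k 1)
  rw [displacement_apply, displacement_apply, ← h1, h0, mul_assoc] at hk
  have hne := h0 ▸ pow_ne_zero (∑ j, (μ.1 j).val * (μ.2 j).val) (tau_ne_zero (p := p))
  rw [← mul_assoc, ← mul_assoc] at hk
  have hk := mul_left_cancel₀ hne hk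
  simp only [Pi.add_apply, if_true] at hk
  have hp : ∀ f : Fin n → ZMod p,
      ∏ j, omega p ^ (((Pi.single k 1 : Fin n → ZMod p) j).val * (f j).val)
        = omega p ^ (f k).val := fun f => by
    have : Fact (1 < p) := ⟨(Fact.out : p.Prime).one_lt⟩
    rw [Finset.prod_eq_single k]
    · simp [ZMod.val_one]
    · intro j _ hj; simp [Pi.single_eq_of_ne hj]
    · intro hk; exact absurd (Finset.mem_univ k) hk
  rw [hp, hp] at hk
  exact ZMod.val_injective p
    (omega_primitive.pow_inj (ZMod.val_lt _) (ZMod.val_lt _) hk)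

/-! ### Clifford groups -/

/-- The (full) Clifford group in dimension `p ^ n`, phase factors included: the unitary
matrices that map displacement operators to displacement operators up to phase factors. -/
def cliffordGroup (p n : ℕ) [Fact p.Prime] : Subgroup (unitaryGroup (Fin n → ZMod p) ℂ) where
  carrier := {U | ∀ μ : PhaseSpace p n, ∃ ν : PhaseSpace p n, ∃ c : ℂ, ‖c‖ = 1 ∧
    (U : Matrix (Fin n → ZMod p) (Fin n → ZMod p) ℂ) * displacement μ * (U : Matrix _ _ ℂ)ᴴ =
      c • displacement ν}
  one_mem' := fun μ => ⟨μ, 1, by simp, by simp⟩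
  mul_mem' := by
    intro U V hU hV μ
    obtain ⟨ν, c, hc, h⟩ := hV μ
    obtain ⟨ξ, e, he, h'⟩ := hU ν
    refine ⟨ξ, c * e, by simp [hc, he], ?_⟩
    calc _ = (U : Matrix _ _ ℂ) * ((V : Matrix _ _ ℂ) * displacement μ * (V : Matrix _ _ ℂ)ᴴ) *
          (U : Matrix _ _ ℂ)ᴴ := by simp [Matrix.mul_assoc]
      _ = _ := by rw [h, Matrix.mul_smul, Matrix.smul_mul, h', smul_smul]
  inv_mem' := by
    intro U hU
    have hUU : (U : Matrix (Fin n → ZMod p) (Fin n → ZMod p) ℂ)ᴴ * (U : Matrix _ _ ℂ) = 1 :=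
      Unitary.coe_star_mul_self U
    have key : ∀ (A B : Matrix (Fin n → ZMod p) (Fin n → ZMod p) ℂ),
        (U : Matrix _ _ ℂ) * A * (U : Matrix _ _ ℂ)ᴴ = B →
          A = (U : Matrix _ _ ℂ)ᴴ * B * (U : Matrix _ _ ℂ) := by
      rintro A _ rfl
      rw [Matrix.mul_assoc, Matrix.mul_assoc, Matrix.mul_assoc, hUU, ← Matrix.mul_assoc,
        ← Matrix.mul_assoc, hUU]
      simp
    choose f c hc hf using hU
    have hc0 : ∀ μ, c μ ≠ 0 := fun μ h => by simpa [h] using hc μ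
    have hinj : Function.Injective f := by
      intro μ ν hμν
      refine eq_of_displacement_eq_smul (c := c μ * (c ν)⁻¹) ?_
      rw [key _ _ (hf μ), key _ _ (hf ν), hμν]
      simp [smul_smul, hc0 ν]
    intro ν
    obtain ⟨μ, rfl⟩ := Finite.surjective_of_injective hinj ν
    refine ⟨μ, (c μ)⁻¹, by simp [hc], ?_⟩
    rw [← Unitary.star_eq_inv, Unitary.coe_star, star_eq_conjTranspose,
      conjTranspose_conjTranspose]
    conv_rhs => rw [key _ _ (hf μ)]
    simp [smul_smul, hc0 μ]

variable {K : Type*} [Field K] [Algebra (ZMod p) K]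

/-- The transformation of `𝔽_p^{2n}` given by a matrix in `SL(2, K)`, when `𝔽_p^{2n}` is
identified with `K²` by `φ`. -/
def slAct (φ : PhaseSpace p n ≃ₗ[ZMod p] (Fin 2 → K)) (g : SpecialLinearGroup (Fin 2) K)
    (μ : PhaseSpace p n) : PhaseSpace p n :=
  φ.symm ((g : Matrix (Fin 2) (Fin 2) K) *ᵥ φ μ)

theorem slAct_one (φ : PhaseSpace p n ≃ₗ[ZMod p] (Fin 2 → K)) (μ : PhaseSpace p n) :
    slAct φ 1 μ = μ := by
  have h : ((1 : SpecialLinearGroup (Fin 2) K) : Matrix (Fin 2) (Fin 2) K) = 1 := rfl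
  rw [slAct, h, Matrix.one_mulVec, LinearEquiv.symm_apply_apply]

theorem slAct_mul (φ : PhaseSpace p n ≃ₗ[ZMod p] (Fin 2 → K))
    (g k : SpecialLinearGroup (Fin 2) K) (μ : PhaseSpace p n) :
    slAct φ (g * k) μ = slAct φ g (slAct φ k μ) := by
  have h : ((g * k : SpecialLinearGroup (Fin 2) K) : Matrix (Fin 2) (Fin 2) K) =
    (g : Matrix (Fin 2) (Fin 2) K) * (k : Matrix (Fin 2) (Fin 2) K) := rfl
  rw [slAct, slAct, slAct, h, LinearEquiv.apply_symm_apply, Matrix.mulVec_mulVec]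

/-- An identification of `𝔽_p^{2n}` with `K²` (so that `K` is a field with `p ^ n` elements) is
symplectic if it embeds `SL(2, K)` into the symplectic group `Sp(2n, p)`. -/
def IsSymplecticIdentification (φ : PhaseSpace p n ≃ₗ[ZMod p] (Fin 2 → K)) : Prop :=
  ∀ (g : SpecialLinearGroup (Fin 2) K) (μ ν : PhaseSpace p n),
    sympl (slAct φ g μ) (slAct φ g ν) = sympl μ ν

/-- Symplectic identifications exist for every finite field: expand the two coordinates in a
basis and in the basis dual to it for the trace form. -/
theorem exists_isSymplecticIdentification [Finite K]
    (h : Module.finrank (ZMod p) K = n) :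
    ∃ φ : PhaseSpace p n ≃ₗ[ZMod p] (Fin 2 → K), IsSymplecticIdentification φ := by
  subst h
  let b := Module.finBasis (ZMod p) K
  let B := Algebra.traceForm (ZMod p) K
  have hB : B.Nondegenerate := traceForm_nondegenerate (ZMod p) K
  let b' := LinearMap.BilinForm.dualBasis B hB b
  let φ : PhaseSpace p (Module.finrank (ZMod p) K) ≃ₗ[ZMod p] (Fin 2 → K) :=
    (b.equivFun.symm.prodCongr b'.equivFun.symm).trans (LinearEquiv.finTwoArrow (ZMod p) K).symm
  have hb : ∀ i j, Algebra.trace (ZMod p) K (b i * b' j) = if i = j then 1 else 0 := by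
    intro i j
    have := LinearMap.BilinForm.apply_dualBasis_left (B := B) hB b j i
    simpa [B, mul_comm, b', Algebra.traceForm_apply] using this
  have hs : ∀ x y : Fin (Module.finrank (ZMod p) K) → ZMod p,
     Algebra.trace (ZMod p) K (b.equivFun.symm x * b'.equivFun.symm y) = ∑ j, x j * y j := by
    intro x y
    simp [Module.Basis.equivFun_symm_apply, Finset.sum_mul_sum, map_sum, hb, mul_comm]
  have key : ∀ μ ν, sympl μ ν = Algebra.trace (ZMod p) K (φ μ 1 * φ ν 0 - φ μ 0 * φ ν 1) := by
    intro μ ν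
    rw [map_sub, mul_comm (φ μ 1)]
    have e0 : ∀ μ, φ μ 0 = b.equivFun.symm μ.1 := fun μ => rfl
    have e1 : ∀ μ, φ μ 1 = b'.equivFun.symm μ.2 := fun μ => rfl
    rw [e0, e1, e0, e1, hs, hs, sympl, Finset.sum_sub_distrib]
    simp [mul_comm]
  refine ⟨φ, fun g μ ν => ?_⟩
  rw [key, key]
  congr 1
  simp only [slAct, LinearEquiv.apply_symm_apply]
  have hd := g.2
  rw [Matrix.det_fin_two] at hd
  simp only [Matrix.mulVec, dotProduct, Fin.sum_univ_two]
  linear_combination (φ μ 1 * φ ν 0 - φ μ 0 * φ ν 1) * hd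

/-- The restricted Clifford group in dimension `p ^ n`, phase factors included: the unitary
matrices for which some `F` in (the image of) `SL(2, K)` satisfies `U D_μ U† ∝ D_{F μ}`
for all `μ`. It is the preimage of `SL(2, K)` in the Clifford group. -/
def restrictedCliffordGroup (φ : PhaseSpace p n ≃ₗ[ZMod p] (Fin 2 → K)) :
    Subgroup (unitaryGroup (Fin n → ZMod p) ℂ) where
  carrier := {U | ∃ g : SpecialLinearGroup (Fin 2) K, ∀ μ : PhaseSpace p n, ∃ c : ℂ, ‖c‖ = 1 ∧
    (U : Matrix (Fin n → ZMod p) (Fin n → ZMod p) ℂ) * displacement μ * (U : Matrix _ _ ℂ)ᴴ =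
      c • displacement (slAct φ g μ)}
  one_mem' := ⟨1, fun μ => ⟨1, by simp, by simp [slAct_one]⟩⟩
  mul_mem' := by
    rintro U V ⟨g, hU⟩ ⟨k, hV⟩
    refine ⟨g * k, fun μ => ?_⟩
    obtain ⟨c, hc, h⟩ := hV μ
    obtain ⟨e, he, h'⟩ := hU (slAct φ k μ)
    refine ⟨c * e, by simp [hc, he], ?_⟩
    have hm : slAct φ (g * k) μ = slAct φ g (slAct φ k μ) := slAct_mul φ g k μ
    calc _ = (U : Matrix _ _ ℂ) * ((V : Matrix _ _ ℂ) * displacement μ * (V : Matrix _ _ ℂ)ᴴ) *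
          (U : Matrix _ _ ℂ)ᴴ := by simp [Matrix.mul_assoc]
      _ = _ := by rw [h, Matrix.mul_smul, Matrix.smul_mul, h', smul_smul, hm]
  inv_mem' := by
    rintro U ⟨g, hU⟩
    refine ⟨g⁻¹, fun μ => ?_⟩
    obtain ⟨c, hc, h⟩ := hU (slAct φ g⁻¹ μ)
    have hm : slAct φ g (slAct φ g⁻¹ μ) = μ := by
      rw [← slAct_mul, mul_inv_cancel, slAct_one]
    have hc0 : c ≠ 0 := fun h => by simp [h] at hc
    have hUU : (U : Matrix (Fin n → ZMod p) (Fin n → ZMod p) ℂ)ᴴ * (U : Matrix _ _ ℂ) = 1 :=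
      Unitary.coe_star_mul_self U
    refine ⟨c⁻¹, by simp [hc], ?_⟩
    rw [← Unitary.star_eq_inv, Unitary.coe_star, star_eq_conjTranspose,
      conjTranspose_conjTranspose]
    rw [hm] at h
    have h2 : displacement μ = c⁻¹ • ((U : Matrix _ _ ℂ) * displacement (slAct φ g⁻¹ μ) *
        (U : Matrix _ _ ℂ)ᴴ) := by
      rw [h, smul_smul, inv_mul_cancel₀ hc0, one_smul]
    rw [h2, Matrix.mul_smul, Matrix.smul_mul]
    congr 1
    rw [Matrix.mul_assoc, Matrix.mul_assoc, Matrix.mul_assoc, hUU, ← Matrix.mul_assoc,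
      ← Matrix.mul_assoc, hUU]
    simp

end Weyl

end CliffordDesign

end

/-!
By invariance of the Haar measure, a group `G` of unitaries, finite modulo phases, is a unitary
`t`-design if and only if every operator on the `t`-partite space that commutes with `U^{⊗ t}` for
all `U ∈ G` commutes with `V^{⊗ t}` for all unitaries `V` (`isGroupDesign_of_forall`,
`IsGroupDesign.conjPow_eq`). All statements are thus about invariant operators.

A map of the phase space that preserves the symplectic product is implemented by a unitary
(`exists_implements`): the operators `X ↦ D_{F μ} X D_μ†` commute, and by Schur's lemma a joint
eigenvector of theirs is a multiple of a unitary matrix. Together with the finiteness of Clifford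
groups modulo phases (`finite_quotient_phases`) this makes the Clifford groups accessible through
their action on the phase space.

*Designs.* Expand an operator invariant under the Clifford group in the frame
`D_μ ⊗ D_ν ⊗ (D_μ D_ν D_l)†`, or `D_μ ⊗ (D_μ D_l)†` for two factors. Invariance under the
displacement operators leaves only the terms with `l = 0`, and for these all phases cancel: the
coefficients are constant on the orbits of pairs `(μ, ν)`, or of vectors `μ`. If nonzero vectors
form one orbit then the operator is a combination of the identity and the swap
(`isGroupDesign_two`); this is so already for `SL(2, q)`. In the multiqubit case there are at most
six orbits of pairs, by Witt's theorem (`exists_sympl_map`), and the orbit sums are combinations of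
the six permutation operators (`isGroupDesign_three`). For `q = 2` the group `SL(2, 2)` has the same
orbits.

*Failures.* The operators `∑_ν D_ν ⊗ D_ν† ⊗ D_ν ⊗ D_ν†` and
`∑_ν D_ν ⊗ D_{f ν} ⊗ (D_ν D_{f ν})†`, for a transformation `f` commuting with the group action on
the phase space, are invariant. They do not commute with diagonal unitaries, as they have nonzero
entries between tuples that are not permutations of each other (`exists_conjPow_sum_ne`). For odd
`p` one takes the identity for `f`; for the restricted Clifford group with `q > 2`, the
multiplication by a scalar of `𝔽_q` other than `0` and `-1`.
-/

set_option linter.unusedSectionVars false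

noncomputable section

namespace CliffordDesign

/-! ### Haar averages and commutants -/

section Commutant

variable {d : Type*} [Fintype d] [DecidableEq d] {t : ℕ}

theorem tensorPow_mul (U V : Matrix d d ℂ) :
    tensorPow t (U * V) = tensorPow t U * tensorPow t V := by
  ext i j
  simp only [tensorPow, Matrix.of_apply, Matrix.mul_apply, ← Finset.prod_mul_distrib]
  rw [Finset.prod_univ_sum, Fintype.piFinset_univ]

theorem tensorPow_one : tensorPow t (1 : Matrix d d ℂ) = 1 := by
  ext i j
  simp only [tensorPow, Matrix.of_apply, Matrix.one_apply]
  rw [Fintype.prod_ite_zero]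
  simp [funext_iff]

theorem tensorPow_conjTranspose (U : Matrix d d ℂ) :
    tensorPow t Uᴴ = (tensorPow t U)ᴴ := by
  ext i j
  simp [tensorPow, Matrix.conjTranspose_apply]

theorem tensorPow_smul (c : ℂ) (U : Matrix d d ℂ) :
    tensorPow t (c • U) = c ^ t • tensorPow t U := by
  ext i j
  simp [tensorPow, Finset.prod_mul_distrib]

/-- The conjugation action `A ↦ U^{⊗ t} A (U^{⊗ t})†` of a unitary matrix on `t`-partite
operators. -/
def conjPow (t : ℕ) (U : unitaryGroup d ℂ) (A : Matrix (Fin t → d) (Fin t → d) ℂ) :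
    Matrix (Fin t → d) (Fin t → d) ℂ :=
  tensorPow t (U : Matrix d d ℂ) * A * (tensorPow t (U : Matrix d d ℂ))ᴴ

theorem conjPow_mul (U V : unitaryGroup d ℂ) (A : Matrix (Fin t → d) (Fin t → d) ℂ) :
    conjPow t (U * V) A = conjPow t U (conjPow t V A) := by
  have h : ((U * V : unitaryGroup d ℂ) : Matrix d d ℂ) = (U : Matrix d d ℂ) * V := rfl
  simp only [conjPow, h, tensorPow_mul, Matrix.conjTranspose_mul, Matrix.mul_assoc]

theorem conjPow_sum {ι : Type*} (s : Finset ι) (U : unitaryGroup d ℂ)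
    (A : ι → Matrix (Fin t → d) (Fin t → d) ℂ) :
    conjPow t U (∑ x ∈ s, A x) = ∑ x ∈ s, conjPow t U (A x) := by
  simp [conjPow, Finset.mul_sum, Finset.sum_mul]

theorem conjPow_smul (c : ℂ) (U : unitaryGroup d ℂ) (A : Matrix (Fin t → d) (Fin t → d) ℂ) :
    conjPow t U (c • A) = c • conjPow t U A := by
  simp [conjPow]

theorem conjPow_add (U : unitaryGroup d ℂ) (A B : Matrix (Fin t → d) (Fin t → d) ℂ) :
    conjPow t U (A + B) = conjPow t U A + conjPow t U B := by
  simp [conjPow, mul_add, add_mul]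

theorem tensorPow_conjTranspose_mul_self (U : unitaryGroup d ℂ) :
    (tensorPow t (U : Matrix d d ℂ))ᴴ * tensorPow t (U : Matrix d d ℂ) = 1 := by
  have h : (U : Matrix d d ℂ)ᴴ * (U : Matrix d d ℂ) = 1 := Unitary.coe_star_mul_self U
  rw [← tensorPow_conjTranspose, ← tensorPow_mul, h, tensorPow_one]

theorem conjPow_eq_self_iff (U : unitaryGroup d ℂ) (A : Matrix (Fin t → d) (Fin t → d) ℂ) :
    conjPow t U A = A ↔
      tensorPow t (U : Matrix d d ℂ) * A = A * tensorPow t (U : Matrix d d ℂ) := by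
  have h := tensorPow_conjTranspose_mul_self (t := t) U
  have h' := mul_eq_one_comm.1 h
  constructor
  · intro hA
    conv_rhs => rw [← hA, conjPow, Matrix.mul_assoc, h, mul_one]
  · intro hA
    rw [conjPow, hA, Matrix.mul_assoc, h', mul_one]

theorem conjPow_phase {P : unitaryGroup d ℂ} (hP : P ∈ phases d)
    (A : Matrix (Fin t → d) (Fin t → d) ℂ) : conjPow t P A = A := by
  obtain ⟨c, hc, hP⟩ := hP
  rw [conjPow_eq_self_iff, hP, tensorPow_smul, tensorPow_one]
  simp

theorem continuous_conjPow_apply (A : Matrix (Fin t → d) (Fin t → d) ℂ) (i j : Fin t → d) :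
    Continuous fun V : unitaryGroup d ℂ => conjPow t V A i j := by
  have hent : ∀ a b : d, Continuous fun V : unitaryGroup d ℂ => (V : Matrix d d ℂ) a b :=
    fun a b => continuous_subtype_val.matrix_elem a b
  have hpow : ∀ k l : Fin t → d,
      Continuous fun V : unitaryGroup d ℂ => tensorPow t (V : Matrix d d ℂ) k l :=
    fun k l => by
      simp only [tensorPow, Matrix.of_apply]
      exact continuous_finsetProd _ fun m _ => hent _ _
  simp only [conjPow, Matrix.mul_apply, Matrix.conjTranspose_apply]
  exact continuous_finsetSum _ fun k _ => (continuous_finsetSum _ fun l _ =>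
    (hpow _ _).mul continuous_const).mul (hpow _ _).star

instance instIsProbabilityMeasureHaarUnitary : IsProbabilityMeasure (haarUnitary d) :=
  ⟨by simpa [haarUnitary] using
    Measure.haarMeasure_self (K₀ := (⊤ : TopologicalSpace.PositiveCompacts (unitaryGroup d ℂ)))⟩

instance instIsHaarMeasureHaarUnitary : (haarUnitary d).IsHaarMeasure :=
  inferInstanceAs (Measure.haarMeasure _).IsHaarMeasure

/-- The unitary group is compact, hence unimodular. -/
instance instIsMulRightInvariantHaarUnitary : (haarUnitary d).IsMulRightInvariant where
  map_mul_right_eq_self g := by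
    have : IsProbabilityMeasure ((haarUnitary d).map (· * g)) :=
      Measure.isProbabilityMeasure_map (measurable_mul_const g).aemeasurable
    exact Measure.isHaarMeasure_eq_of_isProbabilityMeasure _ _

theorem integrable_conjPow_apply (A : Matrix (Fin t → d) (Fin t → d) ℂ) (i j : Fin t → d) :
    Integrable (fun V : unitaryGroup d ℂ => conjPow t V A i j) (haarUnitary d) :=
  (continuous_conjPow_apply A i j).integrable_of_hasCompactSupport
    (HasCompactSupport.of_compactSpace _)

theorem integral_conjPow_of_forall_eq {A : Matrix (Fin t → d) (Fin t → d) ℂ}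
    (hA : ∀ V : unitaryGroup d ℂ, conjPow t V A = A) (i j : Fin t → d) :
    ∫ V, conjPow t V A i j ∂(haarUnitary d) = A i j := by
  simp [hA]

theorem integral_conjPow_conjPow (U : unitaryGroup d ℂ) (A : Matrix (Fin t → d) (Fin t → d) ℂ)
    (i j : Fin t → d) :
    ∫ V, conjPow t V (conjPow t U A) i j ∂(haarUnitary d) =
      ∫ V, conjPow t V A i j ∂(haarUnitary d) := by
  simp only [← conjPow_mul]
  exact integral_mul_right_eq_self (fun V => conjPow t V A i j) U

/-- The Haar average of an operator commutes with all tensor powers of unitaries. -/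
theorem conjPow_integral (U : unitaryGroup d ℂ) (A : Matrix (Fin t → d) (Fin t → d) ℂ) :
    conjPow t U (Matrix.of fun i j => ∫ V, conjPow t V A i j ∂(haarUnitary d)) =
      Matrix.of fun i j => ∫ V, conjPow t V A i j ∂(haarUnitary d) := by
  ext i j
  have key : ∀ B : Matrix (Fin t → d) (Fin t → d) ℂ, conjPow t U B i j =
      ∑ l, ∑ k, tensorPow t (U : Matrix d d ℂ) i k * B k l *
        star (tensorPow t (U : Matrix d d ℂ) j l) := fun B => by
    simp only [conjPow, Matrix.mul_apply, Matrix.conjTranspose_apply, Finset.sum_mul]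
  have hint : ∀ k l, Integrable (fun V : unitaryGroup d ℂ =>
      tensorPow t (U : Matrix d d ℂ) i k * conjPow t V A k l *
        star (tensorPow t (U : Matrix d d ℂ) j l)) (haarUnitary d) := fun k l =>
    ((integrable_conjPow_apply A k l).const_mul _).mul_const _
  have h : ∫ V, conjPow t (U * V) A i j ∂(haarUnitary d) =
      ∫ V, conjPow t V A i j ∂(haarUnitary d) :=
    integral_mul_left_eq_self (fun V => conjPow t V A i j) U
  rw [Matrix.of_apply, ← h, key]
  simp only [conjPow_mul, key (conjPow t _ A), Matrix.of_apply]
  rw [integral_finsetSum _ fun l _ => integrable_finsetSum _ fun k _ => hint k l]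
  refine Finset.sum_congr rfl fun l _ => ?_
  rw [integral_finsetSum _ fun k _ => hint k l]
  refine Finset.sum_congr rfl fun k _ => ?_
  rw [integral_mul_const, integral_const_mul]

theorem conjPow_quotient_out (G : Subgroup (unitaryGroup d ℂ)) (U : G)
    (A : Matrix (Fin t → d) (Fin t → d) ℂ) :
    conjPow t ((U : G ⧸ (phases d).subgroupOf G).out : unitaryGroup d ℂ) A = conjPow t U A := by
  obtain ⟨P, hP⟩ := QuotientGroup.mk_out_eq_mul ((phases d).subgroupOf G) U
  rw [hP, Subgroup.coe_mul, conjPow_mul,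
    conjPow_phase (Subgroup.mem_subgroupOf.1 P.2)]

/-- If a group of unitaries, finite modulo phases, has no more invariant `t`-partite operators
than the whole unitary group, then it is a unitary `t`-design. -/
theorem isGroupDesign_of_forall {G : Subgroup (unitaryGroup d ℂ)}
    [Finite (G ⧸ (phases d).subgroupOf G)]
    (h : ∀ A : Matrix (Fin t → d) (Fin t → d) ℂ, (∀ U ∈ G, conjPow t U A = A) →
      ∀ V : unitaryGroup d ℂ, conjPow t V A = A) :
    IsGroupDesign t G := by
  let _ := Fintype.ofFinite (G ⧸ (phases d).subgroupOf G)
  refine ⟨inferInstance, fun A i j => ?_⟩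
  change (Fintype.card (G ⧸ (phases d).subgroupOf G) : ℂ)⁻¹ *
    ∑ s : G ⧸ (phases d).subgroupOf G, conjPow t (s.out : unitaryGroup d ℂ) A i j =
      ∫ V, conjPow t V A i j ∂(haarUnitary d)
  set c : ℂ := (Fintype.card (G ⧸ (phases d).subgroupOf G) : ℂ)⁻¹
  have hc : c * (Fintype.card (G ⧸ (phases d).subgroupOf G) : ℂ) = 1 :=
    inv_mul_cancel₀ (Nat.cast_ne_zero.2 Fintype.card_ne_zero)
  -- the average of `A` over the group
  set B : Matrix (Fin t → d) (Fin t → d) ℂ :=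
    c • ∑ s : G ⧸ (phases d).subgroupOf G, conjPow t (s.out : unitaryGroup d ℂ) A with hB
  have hBG : ∀ U ∈ G, conjPow t U B = B := by
    intro U hU
    rw [hB, conjPow_smul, conjPow_sum]
    congr 1
    refine Fintype.sum_equiv (MulAction.toPerm (⟨U, hU⟩ : G)) _ _ fun s => ?_
    obtain ⟨g, rfl⟩ := QuotientGroup.mk_surjective s
    rw [conjPow_quotient_out, MulAction.toPerm_apply, MulAction.Quotient.smul_coe,
      conjPow_quotient_out, smul_eq_mul, Subgroup.coe_mul, conjPow_mul]
  have hBV := h B hBG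
  have hlhs : c * ∑ s : G ⧸ (phases d).subgroupOf G,
      conjPow t (s.out : unitaryGroup d ℂ) A i j = B i j := by
    rw [hB, Matrix.smul_apply, Matrix.sum_apply, smul_eq_mul]
  rw [hlhs, ← integral_conjPow_of_forall_eq hBV i j]
  have hV : ∀ V : unitaryGroup d ℂ, conjPow t V B i j =
      c * ∑ s : G ⧸ (phases d).subgroupOf G,
        conjPow t V (conjPow t (s.out : unitaryGroup d ℂ) A) i j := fun V => by
    rw [hB, conjPow_smul, conjPow_sum, Matrix.smul_apply, Matrix.sum_apply, smul_eq_mul]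
  simp only [hV]
  rw [integral_const_mul, integral_finsetSum _ fun s _ => integrable_conjPow_apply _ i j]
  simp only [integral_conjPow_conjPow, Finset.sum_const, Finset.card_univ, nsmul_eq_mul]
  rw [← mul_assoc, hc, one_mul]

/-- An operator invariant under a group that is a `t`-design is invariant under all
unitaries. -/
theorem IsGroupDesign.conjPow_eq {G : Subgroup (unitaryGroup d ℂ)} (hG : IsGroupDesign t G)
    {A : Matrix (Fin t → d) (Fin t → d) ℂ} (hA : ∀ U ∈ G, conjPow t U A = A)
    (V : unitaryGroup d ℂ) : conjPow t V A = A := by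
  obtain ⟨_, hG⟩ := hG
  have h : A = Matrix.of fun i j => ∫ V, conjPow t V A i j ∂(haarUnitary d) := by
    ext i j
    have hij := hG A i j
    change _ * ∑ s : G ⧸ (phases d).subgroupOf G,
      conjPow t (s.out : unitaryGroup d ℂ) A i j = ∫ V, conjPow t V A i j ∂(haarUnitary d) at hij
    rw [Matrix.of_apply, ← hij]
    simp only [fun s : G ⧸ (phases d).subgroupOf G => hA _ s.out.2, Finset.sum_const,
      Finset.card_univ, nsmul_eq_mul]
    rw [inv_mul_cancel_left₀ (Nat.cast_ne_zero.2 Fintype.card_ne_zero)]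
  rw [h]
  exact conjPow_integral V A

end Commutant

/-! ### Relations between displacement operators -/

section Displacement

variable {p : ℕ} [Fact p.Prime] {n : ℕ}

theorem mul_star_eq_one {c : ℂ} (hc : ‖c‖ = 1) : c * star c = 1 := by
  rw [Complex.star_def, Complex.mul_conj', hc]; simp

/-- The additive character `a ↦ ω^a` of `ZMod p`. -/
def rootChar (p : ℕ) [Fact p.Prime] : AddChar (ZMod p) ℂ :=
  AddChar.zmodChar p (omega_primitive (p := p)).pow_eq_one

theorem norm_rootChar (a : ZMod p) : ‖rootChar p a‖ = 1 := AddChar.norm_apply _ _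

theorem rootChar_ne_zero (a : ZMod p) : rootChar p a ≠ 0 := fun h => by
  simpa [h] using norm_rootChar a

theorem rootChar_mul_star (a : ZMod p) : rootChar p a * star (rootChar p a) = 1 :=
  mul_star_eq_one (norm_rootChar a)

theorem rootChar_eq_one_iff {a : ZMod p} : rootChar p a = 1 ↔ a = 0 := by
  constructor
  · intro h
    have h0 : omega p ^ a.val = omega p ^ 0 := by
      rw [pow_zero]; exact h
    have := omega_primitive.pow_inj (ZMod.val_lt _) (Fact.out : p.Prime).pos h0
    exact (ZMod.val_eq_zero a).1 this
  · rintro rfl; simp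

theorem rootChar_sum {ι : Type*} (s : Finset ι) (f : ι → ZMod p) :
    rootChar p (∑ j ∈ s, f j) = ∏ j ∈ s, rootChar p (f j) :=
  map_prod (rootChar p).toMonoidHom (fun j => Multiplicative.ofAdd (f j)) s

theorem norm_tau : ‖tau p‖ = 1 := by
  have h : (Real.pi * Complex.I / p : ℂ) = ((Real.pi / p : ℝ) : ℂ) * Complex.I := by
    push_cast; ring
  rw [tau, norm_neg, h, Complex.norm_exp_ofReal_mul_I]

/-- The scalar prefactor of the displacement operator `D_μ`. -/
def prefactor (μ : PhaseSpace p n) : ℂ := tau p ^ (∑ j, (μ.1 j).val * (μ.2 j).val)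

theorem prefactor_mul_star (μ : PhaseSpace p n) : prefactor μ * star (prefactor μ) = 1 :=
  mul_star_eq_one (by rw [prefactor, norm_pow, norm_tau, one_pow])

theorem displacement_eq (μ : PhaseSpace p n) (u v : Fin n → ZMod p) :
    displacement μ u v = prefactor μ * if u = v + μ.1 then rootChar p (v ⬝ᵥ μ.2) else 0 := by
  rw [displacement_apply, Fintype.prod_ite_zero, prefactor]
  congr 1
  have h : (∀ i, u i = v i + μ.1 i) ↔ u = v + μ.1 := funext_iff.symm
  simp only [h]
  congr 1
  rw [dotProduct, rootChar_sum]
  refine Finset.prod_congr rfl fun j _ => ?_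
  rw [pow_mul, ← ZMod.natCast_zmod_val (v j * μ.2 j), ZMod.natCast_zmod_val,
    ← ZMod.natCast_zmod_val (v j), ← ZMod.natCast_zmod_val (μ.2 j), ← Nat.cast_mul, rootChar,
    AddChar.zmodChar_apply', ← pow_mul]
  simp

theorem displacement_zero : displacement (0 : PhaseSpace p n) = 1 := by
  ext u v
  rw [displacement_eq]
  simp [prefactor, Matrix.one_apply]

/-- Character sums over `𝔽_p^n`. -/
theorem sum_rootChar_dotProduct (w : Fin n → ZMod p) :
    ∑ b : Fin n → ZMod p, rootChar p (w ⬝ᵥ b) = if w = 0 then (p : ℂ) ^ n else 0 := by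
  simp only [dotProduct, rootChar_sum]
  rw [← Fintype.piFinset_univ, ← Finset.prod_univ_sum (fun _ => Finset.univ)
    (fun j b => rootChar p (w j * b))]
  have h : ∀ j, ∑ b, rootChar p (w j * b) = if w j = 0 then (p : ℂ) else 0 := by
    intro j
    split_ifs with hj
    · simp [hj]
    · refine AddChar.sum_eq_zero_of_ne_one (ψ := (rootChar p).mulShift (w j)) fun h => ?_
      have h1 : rootChar p (w j * 1) = 1 := DFunLike.congr_fun h 1
      rw [rootChar_eq_one_iff, mul_one] at h1
      exact hj h1
  simp only [h, Fintype.prod_ite_zero, Finset.prod_const, Finset.card_univ, Fintype.card_fin]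
  simp [funext_iff]

/-- Completeness of the displacement operators: they form an orthogonal basis of the space of
operators. -/
theorem sum_displacement_mul_star (u v u' v' : Fin n → ZMod p) :
    ∑ μ : PhaseSpace p n, displacement μ u v * star (displacement μ u' v') =
      if u = u' ∧ v = v' then (p : ℂ) ^ n else 0 := by
  have h : ∀ a b : Fin n → ZMod p,
      displacement (a, b) u v * star (displacement (a, b) u' v') =
        if u = v + a ∧ u' = v' + a then rootChar p ((v - v') ⬝ᵥ b) else 0 := by
    intro a b
    rw [displacement_eq, displacement_eq, star_mul', mul_mul_mul_comm, prefactor_mul_star, one_mul]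
    by_cases h1 : u = v + a <;> by_cases h2 : u' = v' + a <;> simp [h1, h2]
    rw [sub_eq_add_neg, AddChar.map_add_eq_mul, AddChar.map_neg_eq_conj]
  rw [Fintype.sum_prod_type]
  simp only [h]
  have h2 : ∀ a : Fin n → ZMod p, (∑ b : Fin n → ZMod p,
      if u = v + a ∧ u' = v' + a then rootChar p ((v - v') ⬝ᵥ b) else 0) =
        if a = u - v then (if u = u' ∧ v = v' then (p : ℂ) ^ n else 0) else 0 := by
    clear h
    intro a
    by_cases ha : a = u - v
    · subst ha
      by_cases hu : u' = v' + (u - v)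
      · have : u = v + (u - v) := by abel
        simp only [← this, hu, true_and, if_true]
        rw [sum_rootChar_dotProduct]
        simp only [sub_eq_zero]
        by_cases hv : v = v'
        · subst hv; simp
        · simp [hv]
      · have : ¬(u = u' ∧ v = v') := by rintro ⟨rfl, rfl⟩; exact hu (by abel)
        simp [hu, this]
    · have : ¬ u = v + a := fun h => ha (by rw [h]; abel)
      simp [ha, this]
  simp only [h2, Finset.sum_ite_eq', Finset.mem_univ, if_true]

theorem displacement_mul_displacement_apply (μ ν : PhaseSpace p n) (u v : Fin n → ZMod p) :
    (displacement μ * displacement ν) u v = prefactor μ * prefactor ν *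
      if u = v + ν.1 + μ.1 then rootChar p ((v + ν.1) ⬝ᵥ μ.2 + v ⬝ᵥ ν.2) else 0 := by
  rw [Matrix.mul_apply, Finset.sum_eq_single (v + ν.1)]
  · rw [displacement_eq, displacement_eq]
    split_ifs <;> simp_all [AddChar.map_add_eq_mul]
    ring
  · intro w _ hw
    rw [displacement_eq ν, if_neg hw]; simp
  · simp

theorem displacement_mul_comm (μ ν : PhaseSpace p n) :
    displacement μ * displacement ν =
      rootChar p (sympl μ ν) • (displacement ν * displacement μ) := by
  have hs : sympl μ ν = ν.1 ⬝ᵥ μ.2 - μ.1 ⬝ᵥ ν.2 := by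
    simp [sympl, dotProduct, mul_comm]
  ext u v
  rw [Matrix.smul_apply, displacement_mul_displacement_apply, displacement_mul_displacement_apply,
    add_right_comm v μ.1 ν.1, smul_eq_mul]
  split_ifs
  · rw [mul_left_comm (rootChar p _), ← AddChar.map_add_eq_mul, mul_comm (prefactor μ), hs]
    congr 2
    simp only [add_dotProduct]
    ring
  · simp

theorem displacement_mul_conjTranspose (μ : PhaseSpace p n) :
    displacement μ * (displacement μ)ᴴ = 1 := by
  ext u v
  rw [Matrix.mul_apply, Finset.sum_eq_single (u - μ.1)]
  · rw [conjTranspose_apply, displacement_eq, displacement_eq, star_mul', mul_mul_mul_comm,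
      prefactor_mul_star]
    have h1 : u = u - μ.1 + μ.1 := by abel
    rw [if_pos h1, ← h1, Matrix.one_apply]
    by_cases h : u = v
    · subst h; simp only [if_true, rootChar_mul_star, mul_one]
    · simp [h, Ne.symm h]
  · intro w _ hw
    rw [displacement_eq, if_neg fun h => hw (by rw [h]; abel)]
    simp
  · simp

/-- The displacement operators as elements of the unitary group. -/
def displacementUnitary (μ : PhaseSpace p n) : unitaryGroup (Fin n → ZMod p) ℂ :=
  ⟨displacement μ, mem_unitaryGroup_iff.2 (displacement_mul_conjTranspose μ)⟩

theorem displacement_conjTranspose_mul (μ : PhaseSpace p n) :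
    (displacement μ)ᴴ * displacement μ = 1 :=
  mul_eq_one_comm.1 (displacement_mul_conjTranspose μ)

theorem displacement_conj (μ ν : PhaseSpace p n) :
    displacement μ * displacement ν * (displacement μ)ᴴ =
      rootChar p (sympl μ ν) • displacement ν := by
  rw [displacement_mul_comm, smul_mul_assoc, Matrix.mul_assoc, displacement_mul_conjTranspose,
    mul_one]

theorem sympl_zero_right (μ : PhaseSpace p n) : sympl μ 0 = 0 := by simp [sympl]

theorem sympl_add_right (μ ν ξ : PhaseSpace p n) : sympl μ (ν + ξ) = sympl μ ν + sympl μ ξ := by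
  simp only [sympl, ← Finset.sum_add_distrib, Prod.fst_add, Prod.snd_add, Pi.add_apply]
  exact Finset.sum_congr rfl fun j _ => by ring

theorem sympl_neg_right (μ ν : PhaseSpace p n) : sympl μ (-ν) = -sympl μ ν := by
  simp only [sympl, ← Finset.sum_neg_distrib, Prod.fst_neg, Prod.snd_neg, Pi.neg_apply]
  exact Finset.sum_congr rfl fun j _ => by ring

theorem sympl_smul_right (c : ZMod p) (μ ν : PhaseSpace p n) :
    sympl μ (c • ν) = c * sympl μ ν := by
  simp only [sympl, Finset.mul_sum, Prod.smul_fst, Prod.smul_snd, Pi.smul_apply, smul_eq_mul]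
  exact Finset.sum_congr rfl fun j _ => by ring

theorem sympl_swap (μ ν : PhaseSpace p n) : sympl μ ν = -sympl ν μ := by
  simp only [sympl, ← Finset.sum_neg_distrib]
  exact Finset.sum_congr rfl fun j _ => by ring

theorem sympl_self (μ : PhaseSpace p n) : sympl μ μ = 0 := by
  simp only [sympl]
  exact Finset.sum_eq_zero fun j _ => by ring

/-- Every linear functional is given by the symplectic product with a vector. -/
theorem exists_sympl_eq (f : PhaseSpace p n →ₗ[ZMod p] ZMod p) :
    ∃ z, ∀ μ, f μ = sympl μ z := by
  refine ⟨(fun j => f (0, Pi.single j 1), fun j => -f (Pi.single j 1, 0)), fun μ => ?_⟩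
  have hsingle : ∀ i : Fin n, (fun j => if i = j then (1 : ZMod p) else 0) = Pi.single i 1 :=
    fun i => funext fun j => by simp [Pi.single_apply, eq_comm]
  have h1 : f (μ.1, 0) = ∑ j, μ.1 j * f (Pi.single j 1, 0) :=
    ((f.comp (LinearMap.inl _ _ _)).pi_apply_eq_sum_univ μ.1).trans
      (by simp [hsingle])
  have h2 : f (0, μ.2) = ∑ j, μ.2 j * f (0, Pi.single j 1) :=
    ((f.comp (LinearMap.inr _ _ _)).pi_apply_eq_sum_univ μ.2).trans
      (by simp [hsingle])
  have h : f μ = f (μ.1, 0) + f (0, μ.2) := by rw [← map_add]; simp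
  rw [h, h1, h2, sympl, ← Finset.sum_add_distrib]
  exact Finset.sum_congr rfl fun j _ => by ring

theorem eq_zero_of_sympl {μ : PhaseSpace p n} (h : ∀ ν, sympl ν μ = 0) : μ = 0 := by
  refine Prod.ext (funext fun j => ?_) (funext fun j => ?_)
  · simpa [sympl, Pi.single_apply] using h (0, Pi.single j 1)
  · simpa [sympl, Pi.single_apply] using h (Pi.single j 1, 0)

/-- Averaging over the displacement operators gives the completely depolarizing channel. -/
theorem sum_displacement_conj (M : Matrix (Fin n → ZMod p) (Fin n → ZMod p) ℂ) :
    ∑ μ : PhaseSpace p n, displacement μ * M * (displacement μ)ᴴ =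
      ((p : ℂ) ^ n * M.trace) • (1 : Matrix _ _ ℂ) := by
  ext u v
  have h : ∀ μ : PhaseSpace p n, (displacement μ * M * (displacement μ)ᴴ) u v =
      ∑ l, ∑ k, M k l * (displacement μ u k * star (displacement μ v l)) := fun μ => by
    simp only [Matrix.mul_apply, conjTranspose_apply, Finset.sum_mul]
    exact Finset.sum_congr rfl fun l _ => Finset.sum_congr rfl fun k _ => by ring
  simp only [Matrix.sum_apply, h]
  rw [Finset.sum_comm]
  have h2 : ∀ l, ∑ μ : PhaseSpace p n, ∑ k, M k l *
      (displacement μ u k * star (displacement μ v l)) =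
        if u = v then (p : ℂ) ^ n * M l l else 0 := by
    intro l
    rw [Finset.sum_comm]
    simp only [← Finset.mul_sum, sum_displacement_mul_star]
    by_cases h : u = v <;> simp [h, mul_comm]
  simp only [h2, Matrix.smul_apply, Matrix.one_apply, Matrix.trace, Matrix.diag]
  by_cases h : u = v <;> simp [h, Finset.mul_sum]

/-- Schur's lemma for the displacement operators. -/
theorem exists_eq_smul_one {M : Matrix (Fin n → ZMod p) (Fin n → ZMod p) ℂ}
    (hM : ∀ μ : PhaseSpace p n, displacement μ * M = M * displacement μ) :
    ∃ c : ℂ, M = c • (1 : Matrix _ _ ℂ) := by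
  have h := sum_displacement_conj M
  simp only [hM, Matrix.mul_assoc, displacement_mul_conjTranspose, mul_one, Finset.sum_const,
    Finset.card_univ] at h
  rw [← Nat.cast_smul_eq_nsmul ℂ] at h
  refine ⟨(Fintype.card (PhaseSpace p n) : ℂ)⁻¹ * ((p : ℂ) ^ n * M.trace), ?_⟩
  rw [mul_smul, ← h, smul_smul, inv_mul_cancel₀ (Nat.cast_ne_zero.2 Fintype.card_ne_zero),
    one_smul]

end Displacement

/-! ### Existence and finiteness of Clifford unitaries -/

/-- Finitely many commuting endomorphisms of a nonzero complex vector space of finite dimension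
have a joint eigenvector. -/
theorem exists_joint_eigenvector {ι V : Type*} [AddCommGroup V] [Module ℂ V]
    [FiniteDimensional ℂ V] [Nontrivial V] (T : ι → Module.End ℂ V)
    (hT : ∀ i j, Commute (T i) (T j)) (s : Finset ι) :
    ∃ x : V, x ≠ 0 ∧ ∃ c : ι → ℂ, ∀ i ∈ s, T i x = c i • x := by
  classical
  suffices h : ∃ c : ι → ℂ, (⨅ i ∈ s, (T i).eigenspace (c i)) ≠ ⊥ by
    obtain ⟨c, hc⟩ := h
    obtain ⟨x, hx, hx0⟩ := Submodule.exists_mem_ne_zero_of_ne_bot hc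
    refine ⟨x, hx0, c, fun i hi => ?_⟩
    rw [Submodule.mem_iInf] at hx
    exact Module.End.mem_eigenspace_iff.1 ((Submodule.mem_iInf _).1 (hx i) hi)
  induction s using Finset.induction_on with
  | empty => exact ⟨0, by simp⟩
  | insert a s ha ih =>
    obtain ⟨c, hc⟩ := ih
    set W := ⨅ i ∈ s, (T i).eigenspace (c i) with hW
    have hmem : ∀ x, x ∈ W ↔ ∀ i ∈ s, T i x = c i • x := fun x => by
      simp [hW, Submodule.mem_iInf]
    have hmap : ∀ x ∈ W, T a x ∈ W := fun x hx => by
      rw [hmem] at hx ⊢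
      intro i hi
      have h : T i (T a x) = T a (T i x) := LinearMap.congr_fun (hT i a) x
      rw [h, hx i hi, map_smul]
    have : Nontrivial W := Submodule.nontrivial_iff_ne_bot.2 hc
    obtain ⟨e, he⟩ := Module.End.exists_eigenvalue ((T a).restrict hmap)
    obtain ⟨w, hw⟩ := he.exists_hasEigenvector
    have hw' : T a w = e • (w : V) := congrArg Subtype.val hw.apply_eq_smul
    refine ⟨Function.update c a e, Submodule.ne_bot_iff _ |>.2 ⟨w, ?_, ?_⟩⟩
    · simp only [Submodule.mem_iInf, Module.End.mem_eigenspace_iff]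
      intro i hi
      rcases Finset.mem_insert.1 hi with rfl | hi
      · simpa using hw'
      · rw [Function.update_of_ne (ne_of_mem_of_not_mem hi ha)]
        exact (hmem _).1 w.2 i hi
    · simpa using hw.2

section Clifford

variable {p : ℕ} [Fact p.Prime] {n : ℕ}

/-- A unitary matrix `U` implements a transformation `F` of the phase space if
`U D_μ U† ∝ D_{F μ}` for all `μ`. -/
def Implements (U : unitaryGroup (Fin n → ZMod p) ℂ) (F : PhaseSpace p n → PhaseSpace p n) :
    Prop :=
  ∀ μ, ∃ c : ℂ, ‖c‖ = 1 ∧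
    (U : Matrix (Fin n → ZMod p) (Fin n → ZMod p) ℂ) * displacement μ * (U : Matrix _ _ ℂ)ᴴ =
      c • displacement (F μ)

theorem norm_eq_one_of_smul {d : Type*} [Fintype d] [DecidableEq d] [Nonempty d]
    {M N : Matrix d d ℂ} (hM : M * Mᴴ = 1) (hN : N * Nᴴ = 1) {c : ℂ} (h : M = c • N) :
    ‖c‖ = 1 := by
  obtain ⟨i⟩ := ‹Nonempty d›
  rw [h, conjTranspose_smul, smul_mul_smul_comm, hN] at hM
  have h1 := congrFun (congrFun hM i) i
  rw [Matrix.smul_apply, Matrix.one_apply_eq, smul_eq_mul, mul_one, Complex.star_def,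
    Complex.mul_conj'] at h1
  have h2 : ‖c‖ ^ 2 = 1 := by exact_mod_cast h1
  exact (pow_eq_one_iff_of_nonneg (norm_nonneg _) two_ne_zero).1 h2

theorem conj_mul_conjTranspose_self {d : Type*} [Fintype d] [DecidableEq d] {M : Matrix d d ℂ}
    (U : unitaryGroup d ℂ) (hM : M * Mᴴ = 1) :
    ((U : Matrix d d ℂ) * M * (U : Matrix d d ℂ)ᴴ) *
      ((U : Matrix d d ℂ) * M * (U : Matrix d d ℂ)ᴴ)ᴴ = 1 := by
  have h : (U : Matrix d d ℂ)ᴴ * (U : Matrix d d ℂ) = 1 := Unitary.coe_star_mul_self U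
  have h' : (U : Matrix d d ℂ) * (U : Matrix d d ℂ)ᴴ = 1 := Unitary.coe_mul_star_self U
  calc _ = (U : Matrix d d ℂ) * M * ((U : Matrix d d ℂ)ᴴ * (U : Matrix d d ℂ)) * Mᴴ *
        (U : Matrix d d ℂ)ᴴ := by
        simp only [conjTranspose_mul, conjTranspose_conjTranspose, Matrix.mul_assoc]
    _ = 1 := by rw [h, mul_one, Matrix.mul_assoc (U : Matrix d d ℂ), hM, mul_one, h']

theorem implements_of_forall_exists {U : unitaryGroup (Fin n → ZMod p) ℂ}
    {F : PhaseSpace p n → PhaseSpace p n}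
    (h : ∀ μ, ∃ c : ℂ, (U : Matrix (Fin n → ZMod p) (Fin n → ZMod p) ℂ) * displacement μ *
      (U : Matrix _ _ ℂ)ᴴ = c • displacement (F μ)) : Implements U F := fun μ =>
  let ⟨c, hc⟩ := h μ
  ⟨c, norm_eq_one_of_smul (conj_mul_conjTranspose_self U (displacement_mul_conjTranspose μ))
    (displacement_mul_conjTranspose _) hc, hc⟩

theorem implements_displacementUnitary (ν : PhaseSpace p n) :
    Implements (displacementUnitary ν) id :=
  implements_of_forall_exists fun μ => ⟨_, displacement_conj ν μ⟩

open scoped ComplexOrder in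
/-- Every symplectic transformation is implemented by a unitary matrix: the operators
`X ↦ D_{F μ} X D_μ†` commute with each other, and a joint eigenvector of them is a multiple of
a unitary matrix by Schur's lemma. -/
theorem exists_implements {F : PhaseSpace p n → PhaseSpace p n}
    (hF : ∀ μ ν, sympl (F μ) (F ν) = sympl μ ν) :
    ∃ U : unitaryGroup (Fin n → ZMod p) ℂ, Implements U F := by
  let T : PhaseSpace p n → Module.End ℂ (Matrix (Fin n → ZMod p) (Fin n → ZMod p) ℂ) := fun μ =>
    LinearMap.mulLeft ℂ (displacement (F μ)) ∘ₗ LinearMap.mulRight ℂ (displacement μ)ᴴ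
  have hTa : ∀ μ X, T μ X = displacement (F μ) * (X * (displacement μ)ᴴ) := fun _ _ => rfl
  have hT : ∀ μ ν, Commute (T μ) (T ν) := by
    intro μ ν
    refine LinearMap.ext fun X => ?_
    change T μ (T ν X) = T ν (T μ X)
    rw [hTa, hTa, hTa, hTa]
    calc _ = (displacement (F μ) * displacement (F ν)) * X *
          (displacement μ * displacement ν)ᴴ := by
          simp only [conjTranspose_mul, Matrix.mul_assoc]
      _ = (displacement (F ν) * displacement (F μ)) * X *
          (displacement ν * displacement μ)ᴴ := by
          rw [displacement_mul_comm (F μ), displacement_mul_comm μ, hF, conjTranspose_smul,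
            Matrix.smul_mul, Matrix.smul_mul, Matrix.mul_smul, smul_smul, rootChar_mul_star,
            one_smul]
      _ = _ := by simp only [conjTranspose_mul, Matrix.mul_assoc]
  obtain ⟨Y, hY0, γ, hγ⟩ := exists_joint_eigenvector T hT Finset.univ
  have hY : ∀ μ, displacement (F μ) * Y * (displacement μ)ᴴ = γ μ • Y := fun μ => by
    rw [← hγ μ (Finset.mem_univ _), hTa, Matrix.mul_assoc]
  have hconj : ∀ μ, displacement μ * (Yᴴ * Y) * (displacement μ)ᴴ =
      (star (γ μ) * γ μ) • (Yᴴ * Y) := by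
    intro μ
    calc _ = (displacement (F μ) * Y * (displacement μ)ᴴ)ᴴ *
          (displacement (F μ) * Y * (displacement μ)ᴴ) := by
          simp only [conjTranspose_mul, conjTranspose_conjTranspose, Matrix.mul_assoc]
          rw [← Matrix.mul_assoc (displacement (F μ))ᴴ, displacement_conjTranspose_mul,
            Matrix.one_mul]
      _ = _ := by rw [hY, conjTranspose_smul, smul_mul_smul_comm]
  have htr : (Yᴴ * Y).trace ≠ 0 := fun h => hY0 (trace_conjTranspose_mul_self_eq_zero_iff.1 h)
  have hγ1 : ∀ μ, star (γ μ) * γ μ = 1 := by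
    intro μ
    have h := congrArg Matrix.trace (hconj μ)
    rw [Matrix.trace_mul_comm, ← Matrix.mul_assoc, displacement_conjTranspose_mul,
      Matrix.one_mul, Matrix.trace_smul, smul_eq_mul] at h
    exact mul_right_cancel₀ htr (by rw [one_mul]; exact h.symm)
  obtain ⟨c, hc⟩ := exists_eq_smul_one (M := Yᴴ * Y) fun μ => by
    have h := hconj μ
    rw [hγ1, one_smul] at h
    conv_rhs => rw [← h]
    rw [Matrix.mul_assoc, displacement_conjTranspose_mul, mul_one]
  -- the scalar `c` is a positive real number
  have hcr : c = ((∑ k, Complex.normSq (Y k 0) : ℝ) : ℂ) := by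
    have h := congrFun (congrFun hc 0) 0
    rw [Matrix.smul_apply, Matrix.one_apply_eq, smul_eq_mul, mul_one] at h
    rw [← h, Matrix.mul_apply]
    push_cast
    exact Finset.sum_congr rfl fun k _ => by
      rw [conjTranspose_apply, Complex.normSq_eq_conj_mul_self, Complex.star_def]
  set r : ℝ := ∑ k, Complex.normSq (Y k 0)
  have hr0 : r ≠ 0 := fun h => htr (by rw [hc, hcr, h]; simp)
  have hr : 0 < r := lt_of_le_of_ne (Finset.sum_nonneg fun k _ => Complex.normSq_nonneg _) hr0.symm
  have hs : ((√r : ℝ) : ℂ)⁻¹ * ((√r : ℝ) : ℂ)⁻¹ * (r : ℂ) = 1 := by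
    rw [← mul_inv, ← Complex.ofReal_mul, Real.mul_self_sqrt hr.le,
      inv_mul_cancel₀ (Complex.ofReal_ne_zero.2 hr0)]
  have hU : (((√r : ℝ) : ℂ)⁻¹ • Y)ᴴ * (((√r : ℝ) : ℂ)⁻¹ • Y) = 1 := by
    rw [conjTranspose_smul, smul_mul_smul_comm, hc, hcr, smul_smul]
    simp only [star_inv₀, Complex.star_def, Complex.conj_ofReal]
    rw [hs, one_smul]
  refine ⟨⟨((√r : ℝ) : ℂ)⁻¹ • Y, mem_unitaryGroup_iff'.2 hU⟩,
    implements_of_forall_exists fun μ => ⟨star (γ μ), ?_⟩⟩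
  set U : Matrix (Fin n → ZMod p) (Fin n → ZMod p) ℂ := ((√r : ℝ) : ℂ)⁻¹ • Y
  have hUμ : displacement (F μ) * U = γ μ • (U * displacement μ) := by
    have h : displacement (F μ) * Y = γ μ • (Y * displacement μ) := by
      rw [← Matrix.smul_mul, ← hY, Matrix.mul_assoc, displacement_conjTranspose_mul, mul_one]
    rw [Matrix.mul_smul, h, Matrix.smul_mul, smul_comm]
  have h1 : U * displacement μ = star (γ μ) • (displacement (F μ) * U) := by
    rw [hUμ, smul_smul, hγ1, one_smul]
  change U * displacement μ * Uᴴ = _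
  rw [h1, Matrix.smul_mul, Matrix.mul_assoc, mul_eq_one_comm.1 hU, mul_one]

theorem exists_implements_of_mem_cliffordGroup {U : unitaryGroup (Fin n → ZMod p) ℂ}
    (hU : U ∈ cliffordGroup p n) : ∃ F, Implements U F :=
  ⟨fun μ => (hU μ).choose, fun μ => (hU μ).choose_spec⟩

theorem Implements.mem_cliffordGroup {U : unitaryGroup (Fin n → ZMod p) ℂ}
    {F : PhaseSpace p n → PhaseSpace p n} (h : Implements U F) : U ∈ cliffordGroup p n :=
  fun μ => ⟨F μ, h μ⟩

theorem mem_restrictedCliffordGroup_iff {K : Type*} [Field K] [Algebra (ZMod p) K]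
    {φ : PhaseSpace p n ≃ₗ[ZMod p] (Fin 2 → K)} {U : unitaryGroup (Fin n → ZMod p) ℂ} :
    U ∈ restrictedCliffordGroup φ ↔ ∃ g, Implements U (slAct φ g) := Iff.rfl

theorem restrictedCliffordGroup_le {K : Type*} [Field K] [Algebra (ZMod p) K]
    (φ : PhaseSpace p n ≃ₗ[ZMod p] (Fin 2 → K)) :
    restrictedCliffordGroup φ ≤ cliffordGroup p n := fun _ hU =>
  let ⟨_, hg⟩ := mem_restrictedCliffordGroup_iff.1 hU
  hg.mem_cliffordGroup

theorem displacementUnitary_mem_restrictedCliffordGroup {K : Type*} [Field K]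
    [Algebra (ZMod p) K] (φ : PhaseSpace p n ≃ₗ[ZMod p] (Fin 2 → K)) (ν : PhaseSpace p n) :
    displacementUnitary ν ∈ restrictedCliffordGroup φ :=
  mem_restrictedCliffordGroup_iff.2 ⟨1, by
    rw [show slAct φ 1 = id from funext fun μ => slAct_one φ μ]
    exact implements_displacementUnitary ν⟩

theorem mem_phases_of_commute {U : unitaryGroup (Fin n → ZMod p) ℂ}
    (hU : ∀ μ : PhaseSpace p n, displacement μ * (U : Matrix _ _ ℂ) =
      (U : Matrix _ _ ℂ) * displacement μ) :
    U ∈ phases (Fin n → ZMod p) := by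
  obtain ⟨c, hc⟩ := exists_eq_smul_one hU
  exact ⟨c, norm_eq_one_of_smul (Unitary.coe_mul_star_self U) (by simp) hc, hc⟩

theorem det_displacement_ne_zero (μ : PhaseSpace p n) : (displacement μ).det ≠ 0 := fun h => by
  have h1 := congrArg Matrix.det (displacement_mul_conjTranspose μ)
  rw [Matrix.det_mul, h, zero_mul, Matrix.det_one] at h1
  exact zero_ne_one h1

theorem inv_mul_comm_of_conj_eq {d : Type*} [Fintype d] [DecidableEq d]
    {U V : unitaryGroup d ℂ} {M : Matrix d d ℂ}
    (h : (U : Matrix d d ℂ) * M * (U : Matrix d d ℂ)ᴴ =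
      (V : Matrix d d ℂ) * M * (V : Matrix d d ℂ)ᴴ) :
    M * ((U⁻¹ * V : unitaryGroup d ℂ) : Matrix d d ℂ) =
      ((U⁻¹ * V : unitaryGroup d ℂ) : Matrix d d ℂ) * M := by
  have hUV : ((U⁻¹ * V : unitaryGroup d ℂ) : Matrix d d ℂ) = (U : Matrix d d ℂ)ᴴ * V := rfl
  have hU : (U : Matrix d d ℂ)ᴴ * (U : Matrix d d ℂ) = 1 := Unitary.coe_star_mul_self U
  have hV : (V : Matrix d d ℂ)ᴴ * (V : Matrix d d ℂ) = 1 := Unitary.coe_star_mul_self V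
  rw [hUV]
  calc _ = (U : Matrix d d ℂ)ᴴ * ((U : Matrix d d ℂ) * M * (U : Matrix d d ℂ)ᴴ) * V := by
        simp only [← Matrix.mul_assoc, hU, Matrix.one_mul]
    _ = _ := by
        rw [h]
        simp only [Matrix.mul_assoc, hV, Matrix.mul_one]

/-- A group of Clifford unitaries is finite modulo phases: a unitary matrix is determined up to
a phase by the conjugates of the displacement operators, and comparing determinants shows that
there are only finitely many possibilities for these conjugates. -/
theorem finite_quotient_phases {G : Subgroup (unitaryGroup (Fin n → ZMod p) ℂ)}
    (hG : G ≤ cliffordGroup p n) :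
    Finite (G ⧸ (phases (Fin n → ZMod p)).subgroupOf G) := by
  let N := Fintype.card (Fin n → ZMod p)
  let S : PhaseSpace p n → Set (Matrix (Fin n → ZMod p) (Fin n → ZMod p) ℂ) := fun μ =>
    ⋃ ν : PhaseSpace p n, (fun c : ℂ => c • displacement ν) ''
      {c : ℂ | c ^ N = (displacement μ).det / (displacement ν).det}
  have hS : ∀ μ, Finite (S μ) := fun μ => Set.finite_coe_iff.2 <| Set.finite_iUnion fun ν =>
    Set.Finite.image _ <| by
      refine ((Polynomial.nthRoots N
        ((displacement μ).det / (displacement ν).det)).toFinset.finite_toSet).subset fun c hc => ?_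
      rw [Finset.mem_coe, Multiset.mem_toFinset, Polynomial.mem_nthRoots Fintype.card_pos]
      exact hc
  have hmem : ∀ U ∈ G, ∀ μ, (U : Matrix (Fin n → ZMod p) (Fin n → ZMod p) ℂ) *
      displacement μ * (U : Matrix _ _ ℂ)ᴴ ∈ S μ := by
    intro U hU μ
    obtain ⟨ν, c, -, h⟩ := hG hU μ
    refine Set.mem_iUnion.2 ⟨ν, c, ?_, h.symm⟩
    have hd := congrArg Matrix.det h
    have hUU : (U : Matrix (Fin n → ZMod p) (Fin n → ZMod p) ℂ)ᴴ * (U : Matrix _ _ ℂ) = 1 :=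
      Unitary.coe_star_mul_self U
    rw [Matrix.mul_assoc, Matrix.det_mul_comm, Matrix.mul_assoc, hUU, mul_one,
      Matrix.det_smul] at hd
    change c ^ N = _
    rw [hd, mul_div_cancel_right₀ _ (det_displacement_ne_zero ν)]
  refine Finite.of_injective (β := ∀ μ, S μ)
    (fun x μ => ⟨_, hmem (x.out : unitaryGroup _ ℂ) x.out.2 μ⟩) fun x y hxy => ?_
  rw [← QuotientGroup.out_eq' x, ← QuotientGroup.out_eq' y, QuotientGroup.eq,
    Subgroup.mem_subgroupOf]
  refine mem_phases_of_commute fun μ => ?_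
  exact inv_mul_comm_of_conj_eq (congrArg Subtype.val (congrFun hxy μ))

end Clifford

/-! ### Tensor product operators -/

section TensorOp

variable {d : Type*} [Fintype d] [DecidableEq d] {t : ℕ}

/-- The tensor product `E_0 ⊗ ⋯ ⊗ E_{t-1}`, as a matrix indexed by `t`-tuples. -/
def tensorOp (E : Fin t → Matrix d d ℂ) : Matrix (Fin t → d) (Fin t → d) ℂ :=
  Matrix.of fun i j => ∏ k, E k (i k) (j k)

theorem tensorOp_mul (E F : Fin t → Matrix d d ℂ) :
    tensorOp E * tensorOp F = tensorOp fun k => E k * F k := by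
  ext i j
  simp only [tensorOp, Matrix.of_apply, Matrix.mul_apply, ← Finset.prod_mul_distrib]
  rw [Finset.prod_univ_sum, Fintype.piFinset_univ]

theorem conjPow_tensorOp (U : unitaryGroup d ℂ) (E : Fin t → Matrix d d ℂ) :
    conjPow t U (tensorOp E) =
      tensorOp fun k => (U : Matrix d d ℂ) * E k * (U : Matrix d d ℂ)ᴴ := by
  have h : ∀ V : Matrix d d ℂ, tensorPow t V = tensorOp fun _ => V := fun _ => rfl
  rw [conjPow, ← tensorPow_conjTranspose, h, h, tensorOp_mul, tensorOp_mul]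

/-- The operator permuting the tensor factors. -/
def permOp (σ : Equiv.Perm (Fin t)) : Matrix (Fin t → d) (Fin t → d) ℂ :=
  Matrix.of fun i j => if i = j ∘ σ then 1 else 0

theorem conjPow_permOp (σ : Equiv.Perm (Fin t)) (U : unitaryGroup d ℂ) :
    conjPow t U (permOp σ) = permOp σ := by
  rw [conjPow_eq_self_iff]
  ext i j
  have h : ∀ k : Fin t → d, i = k ∘ σ ↔ k = i ∘ σ.symm := fun k => by
    rw [← Equiv.comp_symm_eq, eq_comm]
  simp only [Matrix.mul_apply, permOp, Matrix.of_apply, mul_ite, mul_one, mul_zero, ite_mul,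
    one_mul, zero_mul, h, Finset.sum_ite_eq', Finset.mem_univ, if_true]
  rw [tensorPow, Matrix.of_apply, Matrix.of_apply]
  exact Fintype.prod_equiv σ _ _ fun k => by simp

theorem trace_conjPow (U : unitaryGroup d ℂ) (T A : Matrix (Fin t → d) (Fin t → d) ℂ) :
    ((conjPow t U T)ᴴ * conjPow t U A).trace = (Tᴴ * A).trace := by
  have h := tensorPow_conjTranspose_mul_self (t := t) U
  set W := tensorPow t (U : Matrix d d ℂ)
  calc _ = (W * (Tᴴ * (Wᴴ * W) * A * Wᴴ)).trace := by
        simp only [conjPow, conjTranspose_mul, conjTranspose_conjTranspose, Matrix.mul_assoc, W]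
    _ = (Tᴴ * A * (Wᴴ * W)).trace := by
        rw [Matrix.trace_mul_comm, h, mul_one, mul_one, Matrix.mul_assoc, h, mul_one]
    _ = _ := by rw [h, mul_one]

/-- The coefficients of an invariant operator transform contragrediently. -/
theorem star_mul_trace_of_conjPow_eq {U : unitaryGroup d ℂ}
    {T T' A : Matrix (Fin t → d) (Fin t → d) ℂ} (hA : conjPow t U A = A) {c : ℂ}
    (h : conjPow t U T = c • T') : star c * (T'ᴴ * A).trace = (Tᴴ * A).trace := by
  rw [← trace_conjPow U T A, hA, h, conjTranspose_smul, Matrix.smul_mul, Matrix.trace_smul,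
    smul_eq_mul]

end TensorOp

section Frame

variable {J ι : Type*} [Fintype J] [DecidableEq J] [Fintype ι]

/-- A finite family of matrices is a tight frame with constant `c` (for the Hilbert–Schmidt inner
product) if `∑_x |T_x⟩⟩⟨⟨T_x| = c`. -/
def IsTightFrame (T : ι → Matrix J J ℂ) (c : ℂ) : Prop :=
  ∀ u v u' v', ∑ x, T x u v * star (T x u' v') = if u = u' ∧ v = v' then c else 0

theorem IsTightFrame.expansion {T : ι → Matrix J J ℂ} {c : ℂ} (hT : IsTightFrame T c)
    (A : Matrix J J ℂ) : c • A = ∑ x, ((T x)ᴴ * A).trace • T x := by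
  ext i j
  have h : ∀ x, (((T x)ᴴ * A).trace • T x) i j =
      ∑ k, ∑ l, A l k * (T x i j * star (T x l k)) := fun x => by
    rw [Matrix.smul_apply, Matrix.trace, smul_eq_mul, Finset.sum_mul]
    refine Finset.sum_congr rfl fun k _ => ?_
    rw [Matrix.diag_apply, Matrix.mul_apply, Finset.sum_mul]
    exact Finset.sum_congr rfl fun l _ => by rw [conjTranspose_apply]; ring
  simp only [Matrix.sum_apply, h]
  rw [Finset.sum_comm]
  have h2 : ∀ k, ∑ x, ∑ l, A l k * (T x i j * star (T x l k)) =
      if j = k then A i k * c else 0 := by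
    clear h
    intro k
    rw [Finset.sum_comm]
    simp only [← Finset.mul_sum, hT i j _ _]
    by_cases h : j = k <;> simp [h]
  simp only [h2, Finset.sum_ite_eq, Finset.mem_univ, if_true, Matrix.smul_apply, smul_eq_mul,
    mul_comm]

theorem IsTightFrame.conjTranspose {T : ι → Matrix J J ℂ} {c : ℂ} (hT : IsTightFrame T c) :
    IsTightFrame (fun x => (T x)ᴴ) c := by
  intro u v u' v'
  have h := hT v' u' v u
  simp only [conjTranspose_apply, star_star]
  simp only [mul_comm (star _), h]
  congr 1
  simp [and_comm, eq_comm]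

theorem IsTightFrame.mul_left {T : ι → Matrix J J ℂ} {c : ℂ} (hT : IsTightFrame T c)
    {U : Matrix J J ℂ} (hU : U * Uᴴ = 1) : IsTightFrame (fun x => U * T x) c := by
  intro u v u' v'
  have h : ∀ x, (U * T x) u v * star ((U * T x) u' v') =
      ∑ k, ∑ l, U u k * star (U u' l) * (T x k v * star (T x l v')) := fun x => by
    rw [Matrix.mul_apply, Matrix.mul_apply, star_sum, Finset.sum_mul_sum]
    exact Finset.sum_congr rfl fun k _ => Finset.sum_congr rfl fun l _ => by
      rw [star_mul']; ring
  simp only [h]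
  rw [Finset.sum_comm]
  have h2 : ∀ k, ∑ x, ∑ l, U u k * star (U u' l) * (T x k v * star (T x l v')) =
      if v = v' then U u k * star (U u' k) * c else 0 := by
    intro k
    rw [Finset.sum_comm]
    simp only [← Finset.mul_sum, hT _ _ _ _]
    by_cases h : v = v' <;> simp [h]
  simp only [h2]
  have h3 := congrFun (congrFun hU u) u'
  rw [Matrix.mul_apply, Matrix.one_apply] at h3
  simp only [conjTranspose_apply] at h3
  by_cases hv : v = v'
  · simp only [hv, if_true, and_true, ← Finset.sum_mul, h3, ite_mul, one_mul, zero_mul]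
  · simp [hv]

end Frame

section DisplacementFrame

variable {p : ℕ} [Fact p.Prime] {n : ℕ}

theorem isTightFrame_displacement :
    IsTightFrame (displacement : PhaseSpace p n → _) ((p : ℂ) ^ n) :=
  sum_displacement_mul_star

/-- Orthogonality of the displacement operators. -/
theorem sum_displacement_orthogonal (μ ν : PhaseSpace p n) :
    ∑ u, ∑ v, star (displacement ν u v) * displacement μ u v =
      if μ = ν then (p : ℂ) ^ n else 0 := by
  have htr : ∑ u, ∑ v, star (displacement ν u v) * displacement μ u v =
      ((displacement ν)ᴴ * displacement μ).trace := by
    rw [Finset.sum_comm]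
    simp [Matrix.trace, Matrix.mul_apply]
  rw [htr]
  split_ifs with h
  · rw [h, displacement_conjTranspose_mul]
    simp
  · by_contra h0
    refine h (sub_eq_zero.1 (eq_zero_of_sympl fun ξ => ?_))
    have h1 : ((displacement ξ * displacement ν * (displacement ξ)ᴴ)ᴴ *
        (displacement ξ * displacement μ * (displacement ξ)ᴴ)).trace =
          ((displacement ν)ᴴ * displacement μ).trace := by
      rw [← Matrix.trace_mul_comm (displacement μ)]
      simp only [conjTranspose_mul, conjTranspose_conjTranspose, Matrix.mul_assoc]
      rw [← Matrix.mul_assoc (displacement ξ)ᴴ (displacement ξ), displacement_conjTranspose_mul,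
        Matrix.one_mul, Matrix.trace_mul_comm]
      simp only [Matrix.mul_assoc]
      rw [displacement_conjTranspose_mul, Matrix.mul_one, Matrix.trace_mul_comm]
    rw [displacement_conj, displacement_conj, conjTranspose_smul, smul_mul_smul_comm,
      Matrix.trace_smul, smul_eq_mul] at h1
    have h2 := mul_right_cancel₀ h0 (h1.trans (one_mul _).symm)
    rw [← rootChar_eq_one_iff (p := p), sub_eq_add_neg, sympl_add_right, sympl_neg_right,
      AddChar.map_add_eq_mul, AddChar.map_neg_eq_conj, mul_comm]
    exact h2

end DisplacementFrame

/-! ### Invariant operators showing that a group is not a design -/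

section InvariantOperators

variable {p : ℕ} [Fact p.Prime] {n : ℕ}

/-- An operator that commutes with the tensor powers of all diagonal unitaries has a nonzero entry
`(i, j)` only if `i` is a permutation of `j`. The operator `∑_μ D_μ ⊗ E_1(μ) ⊗ ⋯ ⊗ E_m(μ)`
violates this as soon as `m ≥ 2` and, for some `μ`, each `E_k(μ)` has a nonzero entry in column
`0` and off the diagonal. -/
theorem exists_conjPow_sum_ne {m : ℕ} (hm : 2 ≤ m)
    (E : PhaseSpace p n → Fin m → Matrix (Fin n → ZMod p) (Fin n → ZMod p) ℂ)
    (μ : PhaseSpace p n) (b : Fin m → Fin n → ZMod p) (hb : ∀ k, b k ≠ 0)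
    (hE : ∀ k, E μ k (b k) 0 ≠ 0) :
    ∃ V : unitaryGroup (Fin n → ZMod p) ℂ,
      conjPow (m + 1) V (∑ ν, tensorOp (Fin.cons (displacement ν) (E ν))) ≠
        ∑ ν, tensorOp (Fin.cons (displacement ν) (E ν)) := by
  by_contra! hV
  set A := ∑ ν, tensorOp (Fin.cons (displacement ν) (E ν)) with hA
  -- a root of unity of order `m + 2` tells the numbers of zeros in tuples of length `m + 1` apart
  obtain ⟨ζ, hζ⟩ : ∃ ζ : ℂ, IsPrimitiveRoot ζ (m + 2) :=
    ⟨_, Complex.isPrimitiveRoot_exp (m + 2) (by omega)⟩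
  have hζ1 : ‖ζ‖ = 1 := hζ.norm'_eq_one (by omega)
  have hζp : ∀ a b : ℕ, a < m + 2 → b < m + 2 → ζ ^ a = ζ ^ b → a = b := fun a b ha hb h =>
    hζ.pow_inj ha hb h
  let w : (Fin n → ZMod p) → ℂ := fun u => if u = 0 then ζ else 1
  have hw : ∀ u, w u * star (w u) = 1 := fun u => by
    refine mul_star_eq_one ?_
    by_cases h : u = 0 <;> simp [w, h, hζ1]
  let W : unitaryGroup (Fin n → ZMod p) ℂ := ⟨Matrix.diagonal w, mem_unitaryGroup_iff.2 <| by
    rw [star_eq_conjTranspose, diagonal_conjTranspose, diagonal_mul_diagonal]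
    simp only [Pi.star_apply, hw, diagonal_one]⟩
  have hWt : tensorPow (m + 1) (W : Matrix (Fin n → ZMod p) (Fin n → ZMod p) ℂ) =
      Matrix.diagonal fun i : Fin (m + 1) → Fin n → ZMod p => ∏ k, w (i k) := by
    ext i j
    simp only [tensorPow, Matrix.of_apply, W, Matrix.diagonal_apply]
    rw [Fintype.prod_ite_zero]
    simp only [funext_iff]
  have hcomm := (conjPow_eq_self_iff W A).1 (hV W)
  rw [hWt] at hcomm
  -- the row label has at most one zero, the column label has at least `m ≥ 2` of them
  have hzero : ∀ u v : Fin n → ZMod p, A (Fin.cons u b) (Fin.cons v 0) = 0 := by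
    intro u v
    by_contra h0
    have h := congrFun (congrFun hcomm (Fin.cons u b)) (Fin.cons v 0)
    rw [Matrix.diagonal_mul, Matrix.mul_diagonal, mul_comm] at h
    have h := mul_left_cancel₀ h0 h
    rw [Fin.prod_univ_succ, Fin.prod_univ_succ] at h
    have hwb : ∀ k, w (b k) = 1 := fun k => if_neg (hb k)
    have hw0 : w 0 = ζ := if_pos rfl
    simp only [Fin.cons_zero, Fin.cons_succ, hwb, Pi.zero_apply, hw0, Finset.prod_const,
      Finset.card_univ, Fintype.card_fin, one_pow, mul_one] at h
    by_cases hu : u = 0 <;> by_cases hv : v = 0 <;> simp only [w, hu, hv, if_true, if_false] at h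
    · have := hζp 1 (m + 1) (by omega) (by omega) (by rw [pow_one, pow_succ', ← h])
      omega
    · have := hζp 1 m (by omega) (by omega) (by rw [pow_one]; exact h.trans (one_mul _))
      omega
    · have := hζp 0 (m + 1) (by omega) (by omega) (by rw [pow_zero, pow_succ', ← h])
      omega
    · have := hζp 0 m (by omega) (by omega) (by rw [pow_zero]; exact h.trans (one_mul _))
      omega
  -- by orthogonality, pairing the first factor with `D_μ` isolates the term of `μ`
  have hsum : ∑ u, ∑ v, star (displacement μ u v) * A (Fin.cons u b) (Fin.cons v 0) =
      (p : ℂ) ^ n * ∏ k, E μ k (b k) 0 := by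
    have h : ∀ u v : Fin n → ZMod p, star (displacement μ u v) *
        A (Fin.cons u b) (Fin.cons v 0) = ∑ ν, (∏ k, E ν k (b k) 0) *
          (star (displacement μ u v) * displacement ν u v) := by
      intro u v
      rw [hA, Matrix.sum_apply, Finset.mul_sum]
      refine Finset.sum_congr rfl fun ν _ => ?_
      rw [tensorOp, Matrix.of_apply, Fin.prod_univ_succ]
      simp only [Fin.cons_zero, Fin.cons_succ, Pi.zero_apply]
      ring
    simp only [h]
    have h2 : ∀ u : Fin n → ZMod p, ∑ v, ∑ ν, (∏ k, E ν k (b k) 0) *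
        (star (displacement μ u v) * displacement ν u v) = ∑ ν, (∏ k, E ν k (b k) 0) *
          ∑ v, star (displacement μ u v) * displacement ν u v := fun u => by
      rw [Finset.sum_comm]
      simp only [Finset.mul_sum]
    simp only [h2]
    rw [Finset.sum_comm]
    simp only [← Finset.mul_sum, sum_displacement_orthogonal]
    simp [mul_comm]
  simp only [hzero, mul_zero, Finset.sum_const_zero] at hsum
  have hp : (p : ℂ) ^ n ≠ 0 := pow_ne_zero _ (Nat.cast_ne_zero.2 (Fact.out : p.Prime).ne_zero)
  exact mul_ne_zero hp (Finset.prod_ne_zero_iff.2 fun k _ => hE k) hsum.symm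

theorem conj_mul {d : Type*} [Fintype d] [DecidableEq d] (U : unitaryGroup d ℂ)
    (M N : Matrix d d ℂ) : (U : Matrix d d ℂ) * (M * N) * (U : Matrix d d ℂ)ᴴ =
      ((U : Matrix d d ℂ) * M * (U : Matrix d d ℂ)ᴴ) *
        ((U : Matrix d d ℂ) * N * (U : Matrix d d ℂ)ᴴ) := by
  have h : (U : Matrix d d ℂ)ᴴ * (U : Matrix d d ℂ) = 1 := Unitary.coe_star_mul_self U
  calc _ = (U : Matrix d d ℂ) * M * ((U : Matrix d d ℂ)ᴴ * (U : Matrix d d ℂ)) * N *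
        (U : Matrix d d ℂ)ᴴ := by rw [h, mul_one, ← Matrix.mul_assoc]
    _ = _ := by simp only [Matrix.mul_assoc]

theorem conj_conjTranspose {d : Type*} [Fintype d] [DecidableEq d] (U : unitaryGroup d ℂ)
    (M : Matrix d d ℂ) : (U : Matrix d d ℂ) * Mᴴ * (U : Matrix d d ℂ)ᴴ =
      ((U : Matrix d d ℂ) * M * (U : Matrix d d ℂ)ᴴ)ᴴ := by
  simp only [conjTranspose_mul, conjTranspose_conjTranspose, Matrix.mul_assoc]

theorem conj_injective {d : Type*} [Fintype d] [DecidableEq d] (U : unitaryGroup d ℂ) :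
    Function.Injective fun M : Matrix d d ℂ => (U : Matrix d d ℂ) * M * (U : Matrix d d ℂ)ᴴ := by
  have h : (U : Matrix d d ℂ)ᴴ * (U : Matrix d d ℂ) = 1 := Unitary.coe_star_mul_self U
  refine Function.LeftInverse.injective
    (g := fun M => (U : Matrix d d ℂ)ᴴ * M * (U : Matrix d d ℂ)) fun M => ?_
  calc _ = ((U : Matrix d d ℂ)ᴴ * (U : Matrix d d ℂ)) * M *
        ((U : Matrix d d ℂ)ᴴ * (U : Matrix d d ℂ)) := by simp only [Matrix.mul_assoc]
    _ = M := by rw [h, Matrix.one_mul, Matrix.mul_one]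

theorem Implements.injective {U : unitaryGroup (Fin n → ZMod p) ℂ}
    {F : PhaseSpace p n → PhaseSpace p n} (h : Implements U F) : Function.Injective F := by
  intro μ ν hμν
  obtain ⟨c, hc, h1⟩ := h μ
  obtain ⟨e, he, h2⟩ := h ν
  have he0 : e ≠ 0 := fun h => by simp [h] at he
  refine eq_of_displacement_eq_smul (c := c * e⁻¹) (conj_injective U ?_)
  change (U : Matrix (Fin n → ZMod p) (Fin n → ZMod p) ℂ) * displacement μ *
    (U : Matrix _ _ ℂ)ᴴ = (U : Matrix _ _ ℂ) * ((c * e⁻¹) • displacement ν) * (U : Matrix _ _ ℂ)ᴴ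
  rw [Matrix.mul_smul, Matrix.smul_mul, h2, smul_smul, h1, hμν, inv_mul_cancel_right₀ he0]

theorem Implements.map_zero {U : unitaryGroup (Fin n → ZMod p) ℂ}
    {F : PhaseSpace p n → PhaseSpace p n} (h : Implements U F) : F 0 = 0 := by
  obtain ⟨c, hc, h0⟩ := h 0
  have hUU : (U : Matrix (Fin n → ZMod p) (Fin n → ZMod p) ℂ) * (U : Matrix _ _ ℂ)ᴴ = 1 :=
    Unitary.coe_mul_star_self U
  rw [displacement_zero, mul_one, hUU, ← displacement_zero] at h0
  exact (eq_of_displacement_eq_smul h0).symm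

/-- Reindexing along the transformation implemented by `U` shows that `∑_ν T_ν` is invariant
under `U` if `U` maps `T_ν` to `T_{F ν}`. -/
theorem conjPow_sum_of_implements {t : ℕ} {U : unitaryGroup (Fin n → ZMod p) ℂ}
    {F : PhaseSpace p n → PhaseSpace p n} (h : Implements U F)
    (T : PhaseSpace p n → Matrix (Fin t → Fin n → ZMod p) (Fin t → Fin n → ZMod p) ℂ)
    (hT : ∀ ν, conjPow t U (T ν) = T (F ν)) : conjPow t U (∑ ν, T ν) = ∑ ν, T ν := by
  rw [conjPow_sum]
  simp only [hT]
  exact Fintype.sum_equiv (Equiv.ofBijective F (Finite.injective_iff_bijective.1 h.injective))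
    _ _ fun _ => rfl

/-- Clifford groups are not unitary 4-designs: the operator `∑_ν D_ν ⊗ D_ν† ⊗ D_ν ⊗ D_ν†` is
invariant. -/
theorem not_isGroupDesign_four (hn : 1 ≤ n) {G : Subgroup (unitaryGroup (Fin n → ZMod p) ℂ)}
    (hG : G ≤ cliffordGroup p n) : ¬ IsGroupDesign 4 G := by
  intro h
  let a : Fin n → ZMod p := fun _ => 1
  have ha : a ≠ 0 := fun h => one_ne_zero (congrFun h ⟨0, hn⟩)
  obtain ⟨V, hV⟩ := exists_conjPow_sum_ne (p := p) (n := n) (m := 3) (by norm_num)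
    (fun ν => ![(displacement ν)ᴴ, displacement ν, (displacement ν)ᴴ]) (a, 0) ![-a, a, -a]
    (by intro k; fin_cases k <;> simp [ha]) (by
      intro k
      have h1 : displacement ((a, 0) : PhaseSpace p n) a 0 ≠ 0 :=
        (displacement_apply_ne_zero_iff _ _ _).2 (by simp)
      have h2 : displacement ((a, 0) : PhaseSpace p n) 0 (-a) ≠ 0 :=
        (displacement_apply_ne_zero_iff _ _ _).2 (by simp)
      fin_cases k <;> simp [h1, h2])
  refine hV (h.conjPow_eq (fun U hU => ?_) V)
  obtain ⟨F, hF⟩ := exists_implements_of_mem_cliffordGroup (hG hU)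
  refine conjPow_sum_of_implements hF _ fun ν => ?_
  obtain ⟨c, hc, hν⟩ := hF ν
  have hcc : c * star c = 1 := mul_star_eq_one hc
  rw [conjPow_tensorOp]
  ext i j
  simp only [tensorOp, Matrix.of_apply, Fin.prod_univ_succ, Fin.prod_univ_zero]
  simp only [Fin.cons_zero, Fin.cons_succ, Matrix.cons_val_zero, Matrix.cons_val_succ,
    conj_conjTranspose, hν, conjTranspose_smul, Matrix.smul_apply, smul_eq_mul, mul_one]
  linear_combination (displacement (F ν) (i 0) (j 0) *
    ((displacement (F ν))ᴴ (i (Fin.succ 0)) (j (Fin.succ 0)) *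
      (displacement (F ν) (i (Fin.succ (Fin.succ 0))) (j (Fin.succ (Fin.succ 0))) *
        (displacement (F ν))ᴴ (i (Fin.succ (Fin.succ (Fin.succ 0))))
          (j (Fin.succ (Fin.succ (Fin.succ 0))))))) * (c * star c + 1) * hcc

/-- A group of Clifford unitaries commuting (on the phase space) with a transformation `f` leaves
the operator `∑_ν D_ν ⊗ D_{f ν} ⊗ (D_ν D_{f ν})†` invariant. -/
theorem not_isGroupDesign_three {G : Subgroup (unitaryGroup (Fin n → ZMod p) ℂ)}
    (f : PhaseSpace p n → PhaseSpace p n)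
    (hG : ∀ U ∈ G, ∃ F, Implements U F ∧ ∀ ν, F (f ν) = f (F ν))
    (μ : PhaseSpace p n) (h1 : (f μ).1 ≠ 0) (h2 : μ.1 + (f μ).1 ≠ 0) : ¬ IsGroupDesign 3 G := by
  intro h
  obtain ⟨V, hV⟩ := exists_conjPow_sum_ne (p := p) (n := n) (m := 2) le_rfl
    (fun ν => ![displacement (f ν), (displacement ν * displacement (f ν))ᴴ]) μ
    ![(f μ).1, -(μ.1 + (f μ).1)]
    (by
      intro k
      fin_cases k
      · exact h1
      · exact neg_ne_zero.2 h2)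
    (by
      intro k
      fin_cases k
      · exact (displacement_apply_ne_zero_iff _ _ _).2 (by simp)
      · change star ((displacement μ * displacement (f μ)) 0 (-(μ.1 + (f μ).1))) ≠ 0
        have h3 : (0 : Fin n → ZMod p) = -(μ.1 + (f μ).1) + (f μ).1 + μ.1 := by abel
        rw [displacement_mul_displacement_apply, if_pos h3]
        have hpre : ∀ ν : PhaseSpace p n, prefactor ν ≠ 0 := fun ν =>
          pow_ne_zero _ tau_ne_zero
        exact star_ne_zero.2 (mul_ne_zero (mul_ne_zero (hpre _) (hpre _)) (rootChar_ne_zero _)))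
  refine hV (h.conjPow_eq (fun U hU => ?_) V)
  obtain ⟨F, hF, hFf⟩ := hG U hU
  refine conjPow_sum_of_implements hF _ fun ν => ?_
  obtain ⟨c, hc, hν⟩ := hF ν
  obtain ⟨e, he, hfν⟩ := hF (f ν)
  have hcc : c * star c = 1 := mul_star_eq_one hc
  have hee : e * star e = 1 := mul_star_eq_one he
  rw [hFf] at hfν
  rw [conjPow_tensorOp]
  ext i j
  simp only [tensorOp, Matrix.of_apply, Fin.prod_univ_succ, Fin.prod_univ_zero]
  simp only [Fin.cons_zero, Fin.cons_succ, Matrix.cons_val_zero, Matrix.cons_val_succ,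
    conj_conjTranspose, conj_mul, hν, hfν, smul_mul_smul_comm,
    conjTranspose_smul, Matrix.smul_apply, smul_eq_mul, mul_one, star_mul']
  linear_combination (displacement (F ν) (i 0) (j 0) *
    (displacement (f (F ν)) (i (Fin.succ 0)) (j (Fin.succ 0)) *
      (displacement (F ν) * displacement (f (F ν)))ᴴ (i (Fin.succ (Fin.succ 0)))
        (j (Fin.succ (Fin.succ 0))))) * (e * star e * hcc + hee)

end InvariantOperators

/-! ### Criteria for unitary 2-designs and 3-designs -/

section DesignCriteria

variable {p : ℕ} [Fact p.Prime] {n : ℕ}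

theorem natCast_pow_ne_zero : (p : ℂ) ^ n ≠ 0 :=
  pow_ne_zero _ (Nat.cast_ne_zero.2 (Fact.out : p.Prime).ne_zero)

/-- The operators `D_μ ⊗ (D_μ D_l)†`. Conjugation by `D_κ^{⊗ 2}` multiplies them by a phase that
depends only on `l`; with `l = 0` they are mapped to each other by every Clifford unitary, without
any phase. -/
def pairOp (μ l : PhaseSpace p n) : Matrix (Fin 2 → Fin n → ZMod p) (Fin 2 → Fin n → ZMod p) ℂ :=
  tensorOp ![displacement μ, (displacement μ * displacement l)ᴴ]

/-- The operators `D_μ ⊗ D_ν ⊗ (D_μ D_ν D_l)†`, the analogue of `pairOp` for three factors. Using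
the product `D_μ D_ν` instead of `D_{μ + ν}` makes the phases of a Clifford unitary cancel. -/
def tripleOp (μ ν l : PhaseSpace p n) :
    Matrix (Fin 3 → Fin n → ZMod p) (Fin 3 → Fin n → ZMod p) ℂ :=
  tensorOp ![displacement μ, displacement ν, (displacement μ * displacement ν * displacement l)ᴴ]

theorem pairOp_apply (μ l : PhaseSpace p n) (i j : Fin 2 → Fin n → ZMod p) :
    pairOp μ l i j = displacement μ (i 0) (j 0) *
      (displacement μ * displacement l)ᴴ (i 1) (j 1) := by
  rw [pairOp, tensorOp, Matrix.of_apply, Fin.prod_univ_two]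
  rfl

theorem tripleOp_apply (μ ν l : PhaseSpace p n) (i j : Fin 3 → Fin n → ZMod p) :
    tripleOp μ ν l i j = displacement μ (i 0) (j 0) * displacement ν (i 1) (j 1) *
      (displacement μ * displacement ν * displacement l)ᴴ (i 2) (j 2) := by
  rw [tripleOp, tensorOp, Matrix.of_apply, Fin.prod_univ_three]
  rfl

theorem isTightFrame_pairOp :
    IsTightFrame (fun x : PhaseSpace p n × PhaseSpace p n => pairOp x.1 x.2)
      ((p : ℂ) ^ n * (p : ℂ) ^ n) := by
  intro i j i' j'
  have h : ∀ μ l : PhaseSpace p n, pairOp μ l i j * star (pairOp μ l i' j') =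
      (displacement μ (i 0) (j 0) * star (displacement μ (i' 0) (j' 0))) *
        ((displacement μ * displacement l)ᴴ (i 1) (j 1) *
          star ((displacement μ * displacement l)ᴴ (i' 1) (j' 1))) := fun μ l => by
    rw [pairOp_apply, pairOp_apply, star_mul']; ring
  have h1 : ∀ (μ : PhaseSpace p n) (u v u' v' : Fin n → ZMod p),
      ∑ l : PhaseSpace p n, (displacement μ * displacement l)ᴴ u v *
        star ((displacement μ * displacement l)ᴴ u' v') =
          if u = u' ∧ v = v' then (p : ℂ) ^ n else 0 := fun μ =>
    (isTightFrame_displacement.mul_left (displacement_mul_conjTranspose μ)).conjTranspose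
  rw [Fintype.sum_prod_type]
  simp only [h, ← Finset.mul_sum, h1]
  rw [← Finset.sum_mul, sum_displacement_mul_star]
  simp only [funext_iff (α := Fin 2), Fin.forall_fin_two]
  split_ifs <;> first | rfl | (exfalso; tauto) | simp

theorem isTightFrame_tripleOp :
    IsTightFrame (fun x : PhaseSpace p n × PhaseSpace p n × PhaseSpace p n =>
      tripleOp x.1 x.2.1 x.2.2) ((p : ℂ) ^ n * ((p : ℂ) ^ n * (p : ℂ) ^ n)) := by
  intro i j i' j'
  have h : ∀ μ ν l : PhaseSpace p n, tripleOp μ ν l i j * star (tripleOp μ ν l i' j') =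
      (displacement μ (i 0) (j 0) * star (displacement μ (i' 0) (j' 0))) *
      ((displacement ν (i 1) (j 1) * star (displacement ν (i' 1) (j' 1))) *
        ((displacement μ * displacement ν * displacement l)ᴴ (i 2) (j 2) *
          star ((displacement μ * displacement ν * displacement l)ᴴ (i' 2) (j' 2)))) :=
      fun μ ν l => by
    rw [tripleOp_apply, tripleOp_apply, star_mul', star_mul']; ring
  have h1 : ∀ (μ ν : PhaseSpace p n) (u v u' v' : Fin n → ZMod p),
      ∑ l : PhaseSpace p n, (displacement μ * displacement ν * displacement l)ᴴ u v *
        star ((displacement μ * displacement ν * displacement l)ᴴ u' v') =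
          if u = u' ∧ v = v' then (p : ℂ) ^ n else 0 := fun μ ν =>
    (isTightFrame_displacement.mul_left (U := displacement μ * displacement ν) (by
      rw [conjTranspose_mul, Matrix.mul_assoc, ← Matrix.mul_assoc (displacement ν),
        displacement_mul_conjTranspose, Matrix.one_mul,
        displacement_mul_conjTranspose])).conjTranspose
  rw [Fintype.sum_prod_type]
  refine (Finset.sum_congr rfl fun μ _ => Fintype.sum_prod_type _).trans ?_
  simp only [h, ← Finset.mul_sum, h1, ← Finset.sum_mul, sum_displacement_mul_star]
  simp only [funext_iff (α := Fin 3), Fin.forall_fin_succ, IsEmpty.forall_iff, and_true]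
  change _ = if (i 0 = i' 0 ∧ i 1 = i' 1 ∧ i 2 = i' 2) ∧ (j 0 = j' 0 ∧ j 1 = j' 1 ∧ j 2 = j' 2)
    then _ else _
  split_ifs <;> first | rfl | (exfalso; tauto) | simp

theorem conjPow_pairOp {U : unitaryGroup (Fin n → ZMod p) ℂ}
    {F : PhaseSpace p n → PhaseSpace p n} (h : Implements U F) {l : PhaseSpace p n} {e : ℂ}
    (hl : (U : Matrix (Fin n → ZMod p) (Fin n → ZMod p) ℂ) * displacement l *
      (U : Matrix _ _ ℂ)ᴴ = e • displacement (F l)) (μ : PhaseSpace p n) :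
    conjPow 2 U (pairOp μ l) = star e • pairOp (F μ) (F l) := by
  obtain ⟨c, hc, hμ⟩ := h μ
  have hcc : c * star c = 1 := mul_star_eq_one hc
  rw [pairOp, conjPow_tensorOp]
  ext i j
  rw [Matrix.smul_apply, pairOp_apply]
  simp only [tensorOp, Matrix.of_apply, Fin.prod_univ_two, Matrix.cons_val_zero,
    Matrix.cons_val_one, conj_conjTranspose, conj_mul, hμ, hl, smul_mul_smul_comm,
    conjTranspose_smul, Matrix.smul_apply, smul_eq_mul, star_mul']
  linear_combination (star e * displacement (F μ) (i 0) (j 0) *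
    (displacement (F μ) * displacement (F l))ᴴ (i 1) (j 1)) * hcc

theorem conjPow_tripleOp {U : unitaryGroup (Fin n → ZMod p) ℂ}
    {F : PhaseSpace p n → PhaseSpace p n} (h : Implements U F) {l : PhaseSpace p n} {e : ℂ}
    (hl : (U : Matrix (Fin n → ZMod p) (Fin n → ZMod p) ℂ) * displacement l *
      (U : Matrix _ _ ℂ)ᴴ = e • displacement (F l)) (μ ν : PhaseSpace p n) :
    conjPow 3 U (tripleOp μ ν l) = star e • tripleOp (F μ) (F ν) (F l) := by
  obtain ⟨c, hc, hμ⟩ := h μ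
  obtain ⟨c', hc', hν⟩ := h ν
  have hcc : c * star c = 1 := mul_star_eq_one hc
  have hcc' : c' * star c' = 1 := mul_star_eq_one hc'
  rw [tripleOp, conjPow_tensorOp]
  ext i j
  rw [Matrix.smul_apply, tripleOp_apply]
  have h2 : ∀ M N L : Matrix (Fin n → ZMod p) (Fin n → ZMod p) ℂ, ![M, N, L] 2 = L :=
    fun _ _ _ => rfl
  simp only [tensorOp, Matrix.of_apply, Fin.prod_univ_three, Matrix.cons_val_zero,
    Matrix.cons_val_one, h2, conj_conjTranspose, conj_mul, hμ, hν, hl,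
    smul_mul_smul_comm, conjTranspose_smul, Matrix.smul_apply, smul_eq_mul, star_mul']
  linear_combination (star e * displacement (F μ) (i 0) (j 0) *
    displacement (F ν) (i 1) (j 1) *
    (displacement (F μ) * displacement (F ν) * displacement (F l))ᴴ (i 2) (j 2)) *
      (c' * star c' * hcc + hcc')

theorem conj_zero (U : unitaryGroup (Fin n → ZMod p) ℂ) :
    (U : Matrix (Fin n → ZMod p) (Fin n → ZMod p) ℂ) * displacement (0 : PhaseSpace p n) *
      (U : Matrix _ _ ℂ)ᴴ = (1 : ℂ) • displacement (0 : PhaseSpace p n) := by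
  rw [displacement_zero, mul_one, one_smul]
  exact Unitary.coe_mul_star_self U

theorem star_rootChar_ne_one {l : PhaseSpace p n} (hl : l ≠ 0) :
    ∃ κ : PhaseSpace p n, star (star (rootChar p (sympl κ l))) ≠ 1 := by
  by_contra! h
  exact hl (eq_zero_of_sympl fun κ => rootChar_eq_one_iff.1 (by simpa using h κ))

/-- Only the terms with `l = 0` contribute to an operator that commutes with the tensor squares
of the displacement operators. -/
theorem expansion_pairOp {A : Matrix (Fin 2 → Fin n → ZMod p) (Fin 2 → Fin n → ZMod p) ℂ}
    (hA : ∀ κ : PhaseSpace p n, conjPow 2 (displacementUnitary κ) A = A) :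
    ((p : ℂ) ^ n * (p : ℂ) ^ n) • A =
      ∑ μ : PhaseSpace p n, ((pairOp μ 0)ᴴ * A).trace • pairOp μ 0 := by
  rw [isTightFrame_pairOp.expansion A, Fintype.sum_prod_type]
  refine Finset.sum_congr rfl fun μ _ => Finset.sum_eq_single 0 (fun l _ hl => ?_) (by simp)
  obtain ⟨κ, hκ⟩ := star_rootChar_ne_one hl
  have h := star_mul_trace_of_conjPow_eq (hA κ)
    (conjPow_pairOp (implements_displacementUnitary κ) (displacement_conj κ l) μ)
  have h0 : ((pairOp μ l)ᴴ * A).trace = 0 := by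
    by_contra h0
    exact hκ (mul_right_cancel₀ h0 (h.trans (one_mul _).symm))
  simp only [h0, zero_smul]

/-- The analogue of `expansion_pairOp` for the tensor cubes. -/
theorem expansion_tripleOp {A : Matrix (Fin 3 → Fin n → ZMod p) (Fin 3 → Fin n → ZMod p) ℂ}
    (hA : ∀ κ : PhaseSpace p n, conjPow 3 (displacementUnitary κ) A = A) :
    ((p : ℂ) ^ n * ((p : ℂ) ^ n * (p : ℂ) ^ n)) • A =
      ∑ μ : PhaseSpace p n, ∑ ν : PhaseSpace p n,
        ((tripleOp μ ν 0)ᴴ * A).trace • tripleOp μ ν 0 := by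
  rw [isTightFrame_tripleOp.expansion A, Fintype.sum_prod_type]
  refine (Finset.sum_congr rfl fun μ _ => Fintype.sum_prod_type _).trans ?_
  refine Finset.sum_congr rfl fun μ _ => Finset.sum_congr rfl fun ν _ =>
    Finset.sum_eq_single 0 (fun l _ hl => ?_) (by simp)
  obtain ⟨κ, hκ⟩ := star_rootChar_ne_one hl
  have h := star_mul_trace_of_conjPow_eq (hA κ)
    (conjPow_tripleOp (implements_displacementUnitary κ) (displacement_conj κ l) μ ν)
  have h0 : ((tripleOp μ ν l)ᴴ * A).trace = 0 := by
    by_contra h0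
    exact hκ (mul_right_cancel₀ h0 (h.trans (one_mul _).symm))
  simp only [h0, zero_smul]

/-- The sum of the operators `D_μ ⊗ D_μ†` is proportional to the swap. -/
theorem sum_pairOp : ∑ μ : PhaseSpace p n, pairOp μ 0 =
    (p : ℂ) ^ n • permOp (d := Fin n → ZMod p) (Equiv.swap 0 1) := by
  ext i j
  simp only [Matrix.sum_apply, pairOp_apply, displacement_zero, mul_one, conjTranspose_apply,
    sum_displacement_mul_star, Matrix.smul_apply, permOp, Matrix.of_apply, funext_iff (α := Fin 2),
    Fin.forall_fin_two, Function.comp_apply, Equiv.swap_apply_left, Equiv.swap_apply_right,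
    smul_eq_mul, mul_ite, mul_one, mul_zero]
  congr 1
  simp [eq_comm]

/-- A group of Clifford unitaries that contains the displacement operators and acts transitively
on the nonzero vectors of the phase space is a unitary 2-design. -/
theorem isGroupDesign_two {G : Subgroup (unitaryGroup (Fin n → ZMod p) ℂ)}
    (hG : G ≤ cliffordGroup p n) (hD : ∀ κ : PhaseSpace p n, displacementUnitary κ ∈ G)
    (htrans : ∀ μ ν : PhaseSpace p n, μ ≠ 0 → ν ≠ 0 → ∃ U ∈ G, ∃ F, Implements U F ∧ F μ = ν) :
    IsGroupDesign 2 G := by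
  have := finite_quotient_phases hG
  refine isGroupDesign_of_forall fun A hA V => ?_
  set a : PhaseSpace p n → ℂ := fun μ => ((pairOp μ 0)ᴴ * A).trace with ha
  have hconst : ∀ μ ν, μ ≠ 0 → ν ≠ 0 → a μ = a ν := by
    intro μ ν hμ hν
    obtain ⟨U, hU, F, hF, rfl⟩ := htrans μ ν hμ hν
    have h0 := conj_zero U
    nth_rw 2 [← hF.map_zero] at h0
    have h := star_mul_trace_of_conjPow_eq (hA U hU) (conjPow_pairOp hF h0 μ)
    rw [hF.map_zero, star_one, star_one, one_mul] at h
    exact h.symm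
  obtain ⟨x, hx⟩ : ∃ x, ∀ μ, μ ≠ 0 → a μ = x := by
    by_cases h : ∃ μ : PhaseSpace p n, μ ≠ 0
    · obtain ⟨μ, hμ⟩ := h
      exact ⟨a μ, fun ν hν => hconst ν μ hν hμ⟩
    · exact ⟨0, fun μ hμ => absurd ⟨μ, hμ⟩ h⟩
  have hexp := expansion_pairOp fun κ => hA _ (hD κ)
  have hsplit : ∀ μ : PhaseSpace p n, ((pairOp μ 0)ᴴ * A).trace • pairOp μ 0 =
      x • pairOp μ 0 + if μ = 0 then (a 0 - x) • pairOp μ 0 else 0 := by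
    intro μ
    change a μ • pairOp μ 0 = _
    split_ifs with h
    · rw [← add_smul, h]; congr 1; ring
    · rw [hx μ h, add_zero]
  have hone : pairOp (0 : PhaseSpace p n) 0 = permOp 1 := by
    ext i j
    simp only [pairOp_apply, displacement_zero, mul_one, conjTranspose_one, permOp,
      Matrix.of_apply, Matrix.one_apply, Equiv.Perm.coe_one, Function.comp_id,
      funext_iff (α := Fin 2), Fin.forall_fin_two]
    split_ifs <;> first | rfl | (exfalso; tauto) | simp
  have hA' : ((p : ℂ) ^ n * (p : ℂ) ^ n) • A =
      (x * (p : ℂ) ^ n) • permOp (Equiv.swap 0 1) + (a 0 - x) • permOp 1 := by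
    rw [hexp, Finset.sum_congr rfl fun μ _ => hsplit μ, Finset.sum_add_distrib, ← Finset.smul_sum,
      sum_pairOp, smul_smul, Finset.sum_ite_eq' _ _ (fun μ => (a 0 - x) • pairOp μ 0),
      if_pos (Finset.mem_univ _), hone]
  have hinv := congrArg (conjPow 2 V) hA'
  rw [conjPow_add, conjPow_smul, conjPow_smul, conjPow_smul, conjPow_permOp, conjPow_permOp,
    ← hA'] at hinv
  exact smul_right_injective _
    (mul_ne_zero (natCast_pow_ne_zero (p := p) (n := n)) natCast_pow_ne_zero) hinv

theorem sum_tripleOp_zero_right : ∑ μ : PhaseSpace p n, tripleOp μ 0 0 =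
    (p : ℂ) ^ n • permOp (d := Fin n → ZMod p) (Equiv.swap 0 2) := by
  ext i j
  simp only [Matrix.sum_apply, tripleOp_apply, displacement_zero, mul_one, conjTranspose_apply,
    mul_right_comm _ ((1 : Matrix _ _ ℂ) _ _), ← Finset.sum_mul]
  rw [sum_displacement_mul_star, Matrix.smul_apply, permOp, Matrix.of_apply, Matrix.one_apply]
  simp only [funext_iff (α := Fin 3), Fin.forall_fin_succ, IsEmpty.forall_iff, and_true]
  change _ = (p : ℂ) ^ n * if i 0 = j 2 ∧ i 1 = j 1 ∧ i 2 = j 0 then 1 else 0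
  simp only [eq_comm (a := j 0)]
  split_ifs <;> first | rfl | (exfalso; tauto) | simp

theorem sum_tripleOp_zero_left : ∑ ν : PhaseSpace p n, tripleOp 0 ν 0 =
    (p : ℂ) ^ n • permOp (d := Fin n → ZMod p) (Equiv.swap 1 2) := by
  ext i j
  simp only [Matrix.sum_apply, tripleOp_apply, displacement_zero, mul_one, one_mul,
    conjTranspose_apply, mul_assoc ((1 : Matrix _ _ ℂ) _ _), ← Finset.mul_sum]
  rw [sum_displacement_mul_star, Matrix.smul_apply, permOp, Matrix.of_apply, Matrix.one_apply]
  simp only [funext_iff (α := Fin 3), Fin.forall_fin_succ, IsEmpty.forall_iff, and_true]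
  change _ = (p : ℂ) ^ n * if i 0 = j 0 ∧ i 1 = j 2 ∧ i 2 = j 1 then 1 else 0
  simp only [eq_comm (a := j 1)]
  split_ifs <;> first | rfl | (exfalso; tauto) | simp

theorem sum_sum_displacement_mul (i0 j0 i1 j1 i2 j2 : Fin n → ZMod p) :
    ∑ μ : PhaseSpace p n, ∑ ν : PhaseSpace p n, displacement μ i0 j0 * displacement ν i1 j1 *
      (displacement μ * displacement ν)ᴴ i2 j2 =
        if i0 = j2 ∧ i1 = j0 ∧ i2 = j1 then (p : ℂ) ^ n * (p : ℂ) ^ n else 0 := by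
  have h : ∀ μ ν : PhaseSpace p n, displacement μ i0 j0 * displacement ν i1 j1 *
      (displacement μ * displacement ν)ᴴ i2 j2 =
        ∑ k, (displacement μ i0 j0 * star (displacement μ j2 k)) *
          (displacement ν i1 j1 * star (displacement ν k i2)) := fun μ ν => by
    rw [conjTranspose_apply, Matrix.mul_apply, star_sum, Finset.mul_sum]
    exact Finset.sum_congr rfl fun k _ => by rw [star_mul']; ring
  have h2 : ∀ μ : PhaseSpace p n, ∑ ν : PhaseSpace p n, ∑ k,
      (displacement μ i0 j0 * star (displacement μ j2 k)) *
          (displacement ν i1 j1 * star (displacement ν k i2)) =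
      if j1 = i2 then displacement μ i0 j0 * star (displacement μ j2 i1) * (p : ℂ) ^ n
        else 0 := fun μ => by
    rw [Finset.sum_comm]
    simp only [← Finset.mul_sum, sum_displacement_mul_star]
    by_cases h : j1 = i2 <;> simp [h]
  simp only [h, h2]
  by_cases hj : j1 = i2
  · simp only [hj, if_true, ← Finset.sum_mul, sum_displacement_mul_star, and_true]
    simp only [eq_comm (a := j0)]
    split_ifs <;> simp
  · simp [hj, Ne.symm hj]

/-- The sum of the operators `D_μ ⊗ D_ν ⊗ (D_μ D_ν)†` is proportional to a cyclic permutation. -/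
theorem sum_tripleOp : ∑ μ : PhaseSpace p n, ∑ ν : PhaseSpace p n, tripleOp μ ν 0 =
    ((p : ℂ) ^ n * (p : ℂ) ^ n) • permOp (d := Fin n → ZMod p) (finRotate 3).symm := by
  ext i j
  simp only [Matrix.sum_apply, tripleOp_apply, displacement_zero, mul_one]
  rw [sum_sum_displacement_mul, Matrix.smul_apply, permOp, Matrix.of_apply]
  simp only [funext_iff (α := Fin 3), Fin.forall_fin_succ, IsEmpty.forall_iff, and_true]
  change _ = (p : ℂ) ^ n * (p : ℂ) ^ n * if i 0 = j 2 ∧ i 1 = j 0 ∧ i 2 = j 1 then 1 else 0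
  split_ifs <;> simp

/-- Twisting by the symplectic product exchanges `D_μ D_ν` and `D_ν D_μ`, which gives the inverse
cyclic permutation. -/
theorem sum_rootChar_smul_tripleOp : ∑ μ : PhaseSpace p n, ∑ ν : PhaseSpace p n,
    rootChar p (sympl μ ν) • tripleOp μ ν 0 =
      ((p : ℂ) ^ n * (p : ℂ) ^ n) • permOp (d := Fin n → ZMod p) (finRotate 3) := by
  ext i j
  have h : ∀ μ ν : PhaseSpace p n, (rootChar p (sympl μ ν) • tripleOp μ ν 0) i j =
      displacement ν (i 1) (j 1) * displacement μ (i 0) (j 0) *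
        (displacement ν * displacement μ)ᴴ (i 2) (j 2) := fun μ ν => by
    rw [Matrix.smul_apply, tripleOp_apply, displacement_zero, mul_one, displacement_mul_comm μ ν,
      conjTranspose_smul, Matrix.smul_apply, smul_eq_mul, smul_eq_mul]
    linear_combination (displacement ν (i 1) (j 1) * displacement μ (i 0) (j 0) *
        (displacement ν * displacement μ)ᴴ (i 2) (j 2)) * rootChar_mul_star (sympl μ ν)
  simp only [Matrix.sum_apply, h]
  rw [Finset.sum_comm, sum_sum_displacement_mul, Matrix.smul_apply, permOp, Matrix.of_apply]
  simp only [funext_iff (α := Fin 3), Fin.forall_fin_succ, IsEmpty.forall_iff, and_true]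
  change _ = (p : ℂ) ^ n * (p : ℂ) ^ n * if i 0 = j 1 ∧ i 1 = j 2 ∧ i 2 = j 0 then 1 else 0
  split_ifs <;> first | rfl | (exfalso; tauto) | simp

/-- In the multiqubit case the squares of the displacement operators are scalars, hence
`D_μ ⊗ D_μ ⊗ (D_μ²)† = D_μ ⊗ D_μ† ⊗ 1`. -/
theorem tripleOp_self_apply (μ : PhaseSpace 2 n) (i j : Fin 3 → Fin n → ZMod 2) :
    tripleOp μ μ 0 i j = displacement μ (i 0) (j 0) * star (displacement μ (j 1) (i 1)) *
      (1 : Matrix _ _ ℂ) (i 2) (j 2) := by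
  obtain ⟨c, hc⟩ := exists_eq_smul_one (M := displacement μ * displacement μ) fun ν => by
    have h : (sympl ν μ + sympl ν μ : ZMod 2) = 0 := CharTwo.add_self_eq_zero _
    rw [← Matrix.mul_assoc, displacement_mul_comm ν μ, Matrix.smul_mul, Matrix.mul_assoc,
      displacement_mul_comm ν μ, Matrix.mul_smul, smul_smul, ← AddChar.map_add_eq_mul, h,
      AddChar.map_zero_eq_one, one_smul, Matrix.mul_assoc]
  have hD : star c • displacement μ = (displacement μ)ᴴ := by
    have h1 : displacement μ = c • (displacement μ)ᴴ := by
      calc displacement μ = (displacement μ * displacement μ) * (displacement μ)ᴴ := by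
            rw [Matrix.mul_assoc, displacement_mul_conjTranspose, mul_one]
        _ = _ := by rw [hc, Matrix.smul_mul, Matrix.one_mul]
    conv_rhs => rw [h1, conjTranspose_smul, conjTranspose_conjTranspose]
  have hD1 := congrFun (congrFun hD (i 1)) (j 1)
  rw [Matrix.smul_apply, conjTranspose_apply, smul_eq_mul] at hD1
  rw [tripleOp_apply, displacement_zero, mul_one, hc, conjTranspose_smul, conjTranspose_one,
    Matrix.smul_apply, smul_eq_mul, ← hD1]
  ring

theorem sum_tripleOp_self : ∑ μ : PhaseSpace 2 n, tripleOp μ μ 0 =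
    (2 : ℂ) ^ n • permOp (d := Fin n → ZMod 2) (Equiv.swap 0 1) := by
  ext i j
  have h2 := fun u v u' v' => sum_displacement_mul_star (p := 2) (n := n) u v u' v'
  simp only [Matrix.sum_apply, tripleOp_self_apply, ← Finset.sum_mul, h2]
  rw [Matrix.smul_apply, permOp, Matrix.of_apply, Matrix.one_apply]
  simp only [funext_iff (α := Fin 3), Fin.forall_fin_succ, IsEmpty.forall_iff, and_true]
  change _ = (2 : ℂ) ^ n * if i 0 = j 1 ∧ i 1 = j 0 ∧ i 2 = j 2 then 1 else 0
  simp only [eq_comm (a := j 0)]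
  split_ifs <;> first | rfl | (exfalso; tauto) | simp

/-- A function that takes equal values at any two points of a set is constant on it. -/
theorem exists_forall_eq_of_pairwise_eq {α : Type*} (P : α → Prop) (a : α → ℂ)
    (h : ∀ x y, P x → P y → a x = a y) : ∃ c, ∀ x, P x → a x = c := by
  by_cases hP : ∃ x, P x
  · obtain ⟨x, hx⟩ := hP
    exact ⟨a x, fun y hy => h y x hy hx⟩
  · exact ⟨0, fun x hx => absurd ⟨x, hx⟩ hP⟩

theorem exists_sympl_eq_one {μ : PhaseSpace 2 n} (hμ : μ ≠ 0) :
    ∃ ν : PhaseSpace 2 n, sympl μ ν = 1 := by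
  by_contra! h
  refine hμ (eq_zero_of_sympl fun ν => ?_)
  have h01 : ∀ a : ZMod 2, a ≠ 1 → a = 0 := by decide
  rw [sympl_swap, h01 _ (h ν), neg_zero]

/-- A group of multiqubit Clifford unitaries that contains the displacement operators and acts
transitively on the pairs of linearly independent vectors with a given symplectic product is a
unitary 3-design. -/
theorem isGroupDesign_three {G : Subgroup (unitaryGroup (Fin n → ZMod 2) ℂ)}
    (hG : G ≤ cliffordGroup 2 n) (hD : ∀ κ : PhaseSpace 2 n, displacementUnitary κ ∈ G)
    (htrans : ∀ μ ν μ' ν' : PhaseSpace 2 n, μ ≠ 0 → ν ≠ 0 → μ ≠ ν → μ' ≠ 0 → ν' ≠ 0 → μ' ≠ ν' →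
      sympl μ ν = sympl μ' ν' → ∃ U ∈ G, ∃ F, Implements U F ∧ F μ = μ' ∧ F ν = ν') :
    IsGroupDesign 3 G := by
  have := finite_quotient_phases hG
  refine isGroupDesign_of_forall fun A hA V => ?_
  set a : PhaseSpace 2 n → PhaseSpace 2 n → ℂ := fun μ ν =>
    ((tripleOp μ ν 0)ᴴ * A).trace with ha
  have hinvar : ∀ U ∈ G, ∀ F, Implements U F → ∀ μ ν, a (F μ) (F ν) = a μ ν := by
    intro U hU F hF μ ν
    have h0 := conj_zero (p := 2) U
    nth_rw 2 [← hF.map_zero] at h0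
    have h := star_mul_trace_of_conjPow_eq (hA U hU) (conjPow_tripleOp hF h0 μ ν)
    rw [hF.map_zero, star_one, star_one, one_mul] at h
    exact h
  have htrans1 : ∀ μ μ' : PhaseSpace 2 n, μ ≠ 0 → μ' ≠ 0 →
      ∃ U ∈ G, ∃ F, Implements U F ∧ F μ = μ' := by
    intro μ μ' hμ hμ'
    obtain ⟨ν, hν⟩ := exists_sympl_eq_one hμ
    obtain ⟨ν', hν'⟩ := exists_sympl_eq_one hμ'
    have hne : ∀ {μ ν : PhaseSpace 2 n}, sympl μ ν = 1 → ν ≠ 0 ∧ μ ≠ ν := by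
      intro μ ν h
      constructor
      · rintro rfl
        rw [sympl_zero_right] at h; exact zero_ne_one h
      · rintro rfl
        rw [sympl_self] at h; exact zero_ne_one h
    obtain ⟨U, hU, F, hF, h1, -⟩ := htrans μ ν μ' ν' hμ (hne hν).1 (hne hν).2 hμ' (hne hν').1
      (hne hν').2 (hν.trans hν'.symm)
    exact ⟨U, hU, F, hF, h1⟩
  obtain ⟨x, hx⟩ := exists_forall_eq_of_pairwise_eq (fun μ : PhaseSpace 2 n => μ ≠ 0)
    (fun μ => a μ 0) fun μ μ' hμ hμ' => by
      obtain ⟨U, hU, F, hF, rfl⟩ := htrans1 μ μ' hμ hμ'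
      simpa only [hF.map_zero] using (hinvar U hU F hF μ 0).symm
  obtain ⟨y, hy⟩ := exists_forall_eq_of_pairwise_eq (fun μ : PhaseSpace 2 n => μ ≠ 0)
    (fun μ => a 0 μ) fun μ μ' hμ hμ' => by
      obtain ⟨U, hU, F, hF, rfl⟩ := htrans1 μ μ' hμ hμ'
      simpa only [hF.map_zero] using (hinvar U hU F hF 0 μ).symm
  obtain ⟨z, hz⟩ := exists_forall_eq_of_pairwise_eq (fun μ : PhaseSpace 2 n => μ ≠ 0)
    (fun μ => a μ μ) fun μ μ' hμ hμ' => by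
      obtain ⟨U, hU, F, hF, rfl⟩ := htrans1 μ μ' hμ hμ'
      exact (hinvar U hU F hF μ μ).symm
  have hpair : ∀ s : ZMod 2, ∃ b, ∀ q : PhaseSpace 2 n × PhaseSpace 2 n,
      (q.1 ≠ 0 ∧ q.2 ≠ 0 ∧ q.1 ≠ q.2 ∧ sympl q.1 q.2 = s) → a q.1 q.2 = b := fun s =>
    exists_forall_eq_of_pairwise_eq _ _ fun q q' hq hq' => by
      obtain ⟨h1, h2, h3, h4⟩ := hq
      obtain ⟨h1', h2', h3', h4'⟩ := hq'
      obtain ⟨U, hU, F, hF, e1, e2⟩ := htrans _ _ _ _ h1 h2 h3 h1' h2' h3' (h4.trans h4'.symm)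
      rw [← e1, ← e2]
      exact (hinvar U hU F hF _ _).symm
  obtain ⟨b, hb⟩ := hpair 0
  obtain ⟨c, hc⟩ := hpair 1
  have hchar0 : rootChar 2 0 = 1 := AddChar.map_zero_eq_one _
  have hchar1 : rootChar 2 1 = -1 := by
    have h1 : rootChar 2 1 * rootChar 2 1 = 1 := by
      rw [← AddChar.map_add_eq_mul, CharTwo.add_self_eq_zero, hchar0]
    rcases mul_self_eq_one_iff.1 h1 with h | h
    · exact absurd (rootChar_eq_one_iff.1 h) one_ne_zero
    · exact h
  have h01 : ∀ s : ZMod 2, s = 0 ∨ s = 1 := by decide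
  -- The orbits of pairs are `(0, 0)`, `(μ, 0)`, `(0, μ)`, `(μ, μ)`, and the independent pairs with
  -- symplectic product `0` or `1`; the six functions below span the functions constant on them,
  -- and each is the coefficient function of a permutation operator.
  have hsplit : ∀ μ ν : PhaseSpace 2 n, a μ ν • tripleOp μ ν 0 =
      ((b + c) / 2) • tripleOp μ ν 0 +
      ((b - c) / 2) • (rootChar 2 (sympl μ ν) • tripleOp μ ν 0) +
      (if ν = 0 then (x - b) • tripleOp μ ν 0 else 0) +
      (if ν = μ then (z - b) • tripleOp μ ν 0 else 0) +
      (if μ = 0 then (y - b) • tripleOp μ ν 0 else 0) +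
      (if μ = 0 then (if ν = 0 then (a 0 0 - x - y - z + 2 * b) • tripleOp μ ν 0 else 0)
        else 0) := by
    intro μ ν
    by_cases hμ : μ = 0
    · subst hμ
      have hs : sympl 0 ν = (0 : ZMod 2) := by rw [sympl_swap, sympl_zero_right, neg_zero]
      by_cases hν : ν = 0
      · subst hν
        simp only [hs, hchar0, if_true, smul_smul, ← add_smul]
        congr 1; ring
      · simp only [hs, hchar0, hν, if_true, if_false, smul_smul, ← add_smul, add_zero]
        rw [show a 0 ν = y from hy ν hν]
        congr 1; ring
    · by_cases hν : ν = 0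
      · subst hν
        simp only [sympl_zero_right, hchar0, hμ, Ne.symm hμ, if_true, if_false, smul_smul,
          ← add_smul, add_zero]
        rw [show a μ 0 = x from hx μ hμ]
        congr 1; ring
      · by_cases hμν : ν = μ
        · subst hμν
          simp only [sympl_self, hchar0, hμ, if_true, if_false, smul_smul, ← add_smul, add_zero]
          rw [show a ν ν = z from hz ν hν]
          congr 1; ring
        · simp only [hμ, hν, hμν, if_false, add_zero, smul_smul, ← add_smul]
          congr 1
          rcases h01 (sympl μ ν) with hs | hs
          · rw [hs, hchar0, hb (μ, ν) ⟨hμ, hν, Ne.symm hμν, hs⟩]; ring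
          · rw [hs, hchar1, hc (μ, ν) ⟨hμ, hν, Ne.symm hμν, hs⟩]; ring
  have hone : tripleOp (0 : PhaseSpace 2 n) 0 0 = permOp 1 := by
    ext i j
    simp only [tripleOp_apply, displacement_zero, mul_one, conjTranspose_one, permOp,
      Matrix.of_apply, Matrix.one_apply, Equiv.Perm.coe_one, Function.comp_id,
      funext_iff (α := Fin 3), Fin.forall_fin_succ, IsEmpty.forall_iff, and_true]
    change _ = if i 0 = j 0 ∧ i 1 = j 1 ∧ i 2 = j 2 then (1 : ℂ) else 0
    split_ifs <;> first | rfl | (exfalso; tauto) | simp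
  have hexp := expansion_tripleOp fun κ => hA _ (hD κ)
  have hsum : ∑ μ : PhaseSpace 2 n, ∑ ν : PhaseSpace 2 n, a μ ν • tripleOp μ ν 0 =
      ((b + c) / 2) • ∑ μ : PhaseSpace 2 n, ∑ ν : PhaseSpace 2 n, tripleOp μ ν 0 +
      ((b - c) / 2) • ∑ μ : PhaseSpace 2 n, ∑ ν : PhaseSpace 2 n,
        rootChar 2 (sympl μ ν) • tripleOp μ ν 0 +
      (x - b) • ∑ μ : PhaseSpace 2 n, tripleOp μ 0 0 +
      (z - b) • ∑ μ : PhaseSpace 2 n, tripleOp μ μ 0 +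
      (y - b) • ∑ ν : PhaseSpace 2 n, tripleOp 0 ν 0 +
      (a 0 0 - x - y - z + 2 * b) • tripleOp (0 : PhaseSpace 2 n) 0 0 := by
    have hμ : ∀ f : PhaseSpace 2 n →
        Matrix (Fin 3 → Fin n → ZMod 2) (Fin 3 → Fin n → ZMod 2) ℂ, ∀ μ : PhaseSpace 2 n,
        ∑ ν, (if μ = 0 then f ν else 0) = if μ = 0 then ∑ ν, f ν else 0 := by
      intro f μ
      split_ifs <;> simp
    simp only [hsplit, Finset.sum_add_distrib, Finset.smul_sum, hμ, Finset.sum_ite_eq',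
      Finset.mem_univ, if_true]
  rw [hsum, sum_tripleOp, sum_rootChar_smul_tripleOp, sum_tripleOp_zero_right, sum_tripleOp_self,
    sum_tripleOp_zero_left, hone] at hexp
  have hinv := congrArg (conjPow 3 V) hexp
  simp only [conjPow_add, conjPow_smul, conjPow_permOp] at hinv
  rw [← hexp] at hinv
  have h2 := natCast_pow_ne_zero (p := 2) (n := n)
  exact smul_right_injective _ (mul_ne_zero h2 (mul_ne_zero h2 h2)) hinv

end DesignCriteria

/-! ### The restricted Clifford group and `SL(2, q)` -/

section SpecialLinear

variable {p : ℕ} [Fact p.Prime] {n : ℕ} {K : Type*} [Field K] [Algebra (ZMod p) K]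

theorem exists_specialLinearGroup_mulVec {x : Fin 2 → K} (hx : x ≠ 0) :
    ∃ g : SpecialLinearGroup (Fin 2) K, (g : Matrix (Fin 2) (Fin 2) K) *ᵥ ![1, 0] = x := by
  by_cases h0 : x 0 = 0
  · have h1 : x 1 ≠ 0 := fun h1 => hx (funext fun i => by fin_cases i <;> simp [h0, h1])
    refine ⟨⟨!![0, -(x 1)⁻¹; x 1, 0], by simp [Matrix.det_fin_two, h1]⟩, ?_⟩
    ext i
    fin_cases i <;> simp [Matrix.mulVec, dotProduct, Fin.sum_univ_two, h0]
  · refine ⟨⟨!![x 0, 0; x 1, (x 0)⁻¹], by simp [Matrix.det_fin_two, h0]⟩, ?_⟩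
    ext i
    fin_cases i <;> simp [Matrix.mulVec, dotProduct, Fin.sum_univ_two]

theorem slAct_eq_of_mulVec_eq (φ : PhaseSpace p n ≃ₗ[ZMod p] (Fin 2 → K))
    {g h : SpecialLinearGroup (Fin 2) K} {e : Fin 2 → K} {μ ν : PhaseSpace p n}
    (hg : (g : Matrix (Fin 2) (Fin 2) K) *ᵥ e = φ μ)
    (hh : (h : Matrix (Fin 2) (Fin 2) K) *ᵥ e = φ ν) : slAct φ (h * g⁻¹) μ = ν := by
  have h1 : μ = slAct φ g (φ.symm e) := by
    rw [slAct, LinearEquiv.apply_symm_apply, hg, LinearEquiv.symm_apply_apply]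
  rw [h1, ← slAct_mul, inv_mul_cancel_right, slAct, LinearEquiv.apply_symm_apply, hh,
    LinearEquiv.symm_apply_apply]

theorem exists_slAct_eq (φ : PhaseSpace p n ≃ₗ[ZMod p] (Fin 2 → K)) {μ ν : PhaseSpace p n}
    (hμ : μ ≠ 0) (hν : ν ≠ 0) : ∃ g, slAct φ g μ = ν := by
  obtain ⟨g, hg⟩ := exists_specialLinearGroup_mulVec (φ.map_ne_zero_iff.2 hμ)
  obtain ⟨h, hh⟩ := exists_specialLinearGroup_mulVec (φ.map_ne_zero_iff.2 hν)
  exact ⟨h * g⁻¹, slAct_eq_of_mulVec_eq φ hg hh⟩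

theorem isGroupDesign_two_restrictedCliffordGroup
    {φ : PhaseSpace p n ≃ₗ[ZMod p] (Fin 2 → K)} (hφ : IsSymplecticIdentification φ) :
    IsGroupDesign 2 (restrictedCliffordGroup φ) := by
  refine isGroupDesign_two (restrictedCliffordGroup_le φ)
    (displacementUnitary_mem_restrictedCliffordGroup φ) fun μ ν hμ hν => ?_
  obtain ⟨g, hg⟩ := exists_slAct_eq φ hμ hν
  obtain ⟨U, hU⟩ := exists_implements (hφ g)
  exact ⟨U, mem_restrictedCliffordGroup_iff.2 ⟨g, hU⟩, _, hU, hg⟩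

theorem isGroupDesign_two_cliffordGroup (hn : 1 ≤ n) : IsGroupDesign 2 (cliffordGroup p n) := by
  obtain ⟨φ, hφ⟩ := exists_isSymplecticIdentification (K := GaloisField p n) (p := p) (n := n)
    (GaloisField.finrank p (by omega))
  refine isGroupDesign_two le_rfl (fun κ => (implements_displacementUnitary κ).mem_cliffordGroup)
    fun μ ν hμ hν => ?_
  obtain ⟨g, hg⟩ := exists_slAct_eq φ hμ hν
  obtain ⟨U, hU⟩ := exists_implements (hφ g)
  exact ⟨U, hU.mem_cliffordGroup, _, hU, hg⟩

/-- Over the field with two elements, any two distinct nonzero vectors of the plane are the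
columns of a matrix in `SL(2, 2)`. -/
theorem exists_specialLinearGroup_mulVec_pair (hK : ∀ x : K, x = 0 ∨ x = 1) {x y : Fin 2 → K}
    (hx : x ≠ 0) (hy : y ≠ 0) (hxy : x ≠ y) : ∃ g : SpecialLinearGroup (Fin 2) K,
      (g : Matrix (Fin 2) (Fin 2) K) *ᵥ ![1, 0] = x ∧
      (g : Matrix (Fin 2) (Fin 2) K) *ᵥ ![0, 1] = y := by
  have hdet : x 0 * y 1 - y 0 * x 1 ≠ 0 := by
    intro h
    simp only [ne_eq, funext_iff, Fin.forall_fin_two, Pi.zero_apply] at hx hy hxy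
    rcases hK (x 0) with h1 | h1 <;> rcases hK (x 1) with h2 | h2 <;>
      rcases hK (y 0) with h3 | h3 <;> rcases hK (y 1) with h4 | h4 <;>
      simp [h1, h2, h3, h4] at h hx hy hxy
  refine ⟨⟨!![x 0, y 0; x 1, y 1], ?_⟩, ?_, ?_⟩
  · rw [Matrix.det_fin_two]
    simpa using (hK _).resolve_left hdet
  · ext i
    fin_cases i <;> simp [Matrix.mulVec, dotProduct, Fin.sum_univ_two]
  · ext i
    fin_cases i <;> simp [Matrix.mulVec, dotProduct, Fin.sum_univ_two]

theorem natCard_eq_pow_of_linearEquiv (φ : PhaseSpace p n ≃ₗ[ZMod p] (Fin 2 → K)) :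
    Nat.card K = p ^ n := by
  have h := Nat.card_congr φ.toEquiv
  rw [Nat.card_prod, Nat.card_fun, Nat.card_fun, Nat.card_fin, Nat.card_fin, Nat.card_zmod,
    ← pow_two] at h
  exact (Nat.pow_left_injective two_ne_zero h).symm

theorem isGroupDesign_three_restrictedCliffordGroup [Algebra (ZMod 2) K]
    {φ : PhaseSpace 2 1 ≃ₗ[ZMod 2] (Fin 2 → K)} (hφ : IsSymplecticIdentification φ) :
    IsGroupDesign 3 (restrictedCliffordGroup φ) := by
  -- the field has two elements
  have hK : ∀ x : K, x = 0 ∨ x = 1 := by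
    have h := natCard_eq_pow_of_linearEquiv φ
    rw [pow_one] at h
    obtain ⟨y, -, hy⟩ := (Nat.card_eq_two_iff' (0 : K)).1 h
    intro x
    by_cases hx : x = 0
    · exact Or.inl hx
    · exact Or.inr ((hy x hx).trans (hy 1 one_ne_zero).symm)
  refine isGroupDesign_three (restrictedCliffordGroup_le φ)
    (displacementUnitary_mem_restrictedCliffordGroup φ) fun μ ν μ' ν' h1 h2 h3 h1' h2' h3' _ => ?_
  obtain ⟨g, hg1, hg2⟩ := exists_specialLinearGroup_mulVec_pair hK (φ.map_ne_zero_iff.2 h1)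
    (φ.map_ne_zero_iff.2 h2) (φ.injective.ne h3)
  obtain ⟨g', hg1', hg2'⟩ := exists_specialLinearGroup_mulVec_pair hK (φ.map_ne_zero_iff.2 h1')
    (φ.map_ne_zero_iff.2 h2') (φ.injective.ne h3')
  obtain ⟨U, hU⟩ := exists_implements (hφ (g' * g⁻¹))
  exact ⟨U, mem_restrictedCliffordGroup_iff.2 ⟨_, hU⟩, _, hU, slAct_eq_of_mulVec_eq φ hg1 hg1',
    slAct_eq_of_mulVec_eq φ hg2 hg2'⟩

/-- If `K` has more than two elements then multiplication by a scalar other than `0` and `-1`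
provides an operator invariant under the restricted Clifford group but not under the whole
unitary group. -/
theorem not_isGroupDesign_three_restrictedCliffordGroup (hn : 1 ≤ n)
    (φ : PhaseSpace p n ≃ₗ[ZMod p] (Fin 2 → K)) (hq : 2 < p ^ n) :
    ¬ IsGroupDesign 3 (restrictedCliffordGroup φ) := by
  obtain ⟨k, hk0, hk1⟩ : ∃ k : K, k ≠ 0 ∧ 1 + k ≠ 0 := by
    by_contra! h
    have huniv : (Set.univ : Set K) ⊆ {0, -1} := fun k _ => by
      by_cases hk : k = 0
      · exact Or.inl hk
      · exact Or.inr (eq_neg_of_add_eq_zero_right (h k hk))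
    have hle := Set.ncard_le_ncard huniv (Set.toFinite _)
    rw [Set.ncard_univ, natCard_eq_pow_of_linearEquiv φ] at hle
    have := hle.trans (Set.ncard_insert_le _ _)
    rw [Set.ncard_singleton] at this
    omega
  let f : K → PhaseSpace p n → PhaseSpace p n := fun k μ => φ.symm (k • φ μ)
  have hf_add : ∀ k μ ν, f k (μ + ν) = f k μ + f k ν := fun k μ ν => by simp [f]
  have hf_one : ∀ μ, f (1 + k) μ = μ + f k μ := fun μ => by simp [f, add_smul]
  have hf_ne : ∀ k : K, k ≠ 0 → ∃ μ, (f k μ).1 ≠ 0 := fun k hk => by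
    refine ⟨f k⁻¹ (1, 0), fun h => ?_⟩
    simp only [f, LinearEquiv.apply_symm_apply, smul_smul, mul_inv_cancel₀ hk, one_smul,
      LinearEquiv.symm_apply_apply] at h
    exact one_ne_zero (congrFun h ⟨0, hn⟩)
  -- two proper subgroups do not cover the phase space
  obtain ⟨μ, h1, h2⟩ : ∃ μ, (f k μ).1 ≠ 0 ∧ (f (1 + k) μ).1 ≠ 0 := by
    obtain ⟨x, hx⟩ := hf_ne k hk0
    obtain ⟨y, hy⟩ := hf_ne (1 + k) hk1
    by_cases hx' : (f (1 + k) x).1 = 0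
    · by_cases hy' : (f k y).1 = 0
      · exact ⟨x + y, by rw [hf_add, Prod.fst_add, hy', add_zero]; exact hx,
          by rw [hf_add, Prod.fst_add, hx', zero_add]; exact hy⟩
      · exact ⟨y, hy', hy⟩
    · exact ⟨x, hx, hx'⟩
  refine not_isGroupDesign_three (f k) (fun U hU => ?_) μ h1 ?_
  · obtain ⟨g, hg⟩ := mem_restrictedCliffordGroup_iff.1 hU
    exact ⟨_, hg, fun ν => by simp [f, slAct, Matrix.mulVec_smul]⟩
  · rw [hf_one] at h2
    exact h2

/-- In odd characteristic the operator `∑_ν D_ν ⊗ D_ν ⊗ (D_ν²)†` is invariant under the full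
Clifford group but not under the whole unitary group. -/
theorem not_isGroupDesign_three_of_odd (hn : 1 ≤ n) (hp : p ≠ 2) :
    ¬ IsGroupDesign 3 (cliffordGroup p n) := by
  refine not_isGroupDesign_three id (fun U hU => ?_) ((fun _ => 1), 0) (fun h => ?_) fun h => ?_
  · obtain ⟨F, hF⟩ := exists_implements_of_mem_cliffordGroup hU
    exact ⟨F, hF, fun _ => rfl⟩
  · exact one_ne_zero (congrFun h ⟨0, hn⟩)
  · have h2 : (2 : ZMod p) = 0 := by
      rw [← one_add_one_eq_two]
      exact congrFun h ⟨0, hn⟩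
    have h3 : ((2 : ℕ) : ZMod p) = 0 := by exact_mod_cast h2
    exact hp ((Nat.prime_dvd_prime_iff_eq Fact.out Nat.prime_two).1
      ((ZMod.natCast_eq_zero_iff 2 p).1 h3))

end SpecialLinear

/-! ### Multiqubit Clifford groups and symplectic transvections -/

section Transvection

variable {n : ℕ}

theorem phaseSpace_add_self (μ : PhaseSpace 2 n) : μ + μ = 0 := by
  ext <;> exact CharTwo.add_self_eq_zero _

theorem sympl_comm (μ ν : PhaseSpace 2 n) : sympl μ ν = sympl ν μ := by
  rw [sympl_swap, ZMod.neg_eq_self_mod_two]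

theorem sympl_add_left (μ ν ξ : PhaseSpace 2 n) : sympl (μ + ν) ξ = sympl μ ξ + sympl ν ξ := by
  rw [sympl_comm, sympl_add_right, sympl_comm ξ, sympl_comm ξ]

/-- The symplectic transvection along `w`. -/
def transvec (w μ : PhaseSpace 2 n) : PhaseSpace 2 n := μ + sympl μ w • w

theorem sympl_transvec (w μ ν : PhaseSpace 2 n) :
    sympl (transvec w μ) (transvec w ν) = sympl μ ν := by
  simp only [transvec, sympl_add_left, sympl_add_right, sympl_smul_right, sympl_self,
    sympl_comm (sympl μ w • w), sympl_comm ν w]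
  have h := CharTwo.add_self_eq_zero (sympl w ν * sympl μ w)
  linear_combination h

theorem injective_of_sympl {F : PhaseSpace 2 n → PhaseSpace 2 n}
    (hF : ∀ μ ν, sympl (F μ) (F ν) = sympl μ ν) : Function.Injective F := by
  intro μ ν h
  refine sub_eq_zero.1 (eq_zero_of_sympl fun ξ => ?_)
  rw [sub_eq_add_neg, sympl_add_right, sympl_neg_right, ← hF, h, hF, add_neg_cancel]

theorem zmod_two_eq_zero_or_one (a : ZMod 2) : a = 0 ∨ a = 1 := by
  revert a; decide

/-- A consistent system of linear equations given by the symplectic products with three vectors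
is solvable. -/
theorem exists_forall_sympl_eq (v : Fin 3 → PhaseSpace 2 n) (c : Fin 3 → ZMod 2)
    (h : ∀ g : Fin 3 → ZMod 2, ∑ i, g i • v i = 0 → ∑ i, g i * c i = 0) :
    ∃ z, ∀ i, sympl (v i) z = c i := by
  let f : (Fin 3 → ZMod 2) →ₗ[ZMod 2] PhaseSpace 2 n := Fintype.linearCombination (ZMod 2) v
  let e : (Fin 3 → ZMod 2) →ₗ[ZMod 2] ZMod 2 := Fintype.linearCombination (ZMod 2) c
  have he : e ∈ (LinearMap.ker f).dualAnnihilator := by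
    rw [Submodule.mem_dualAnnihilator]
    intro g hg
    have h1 : ∑ i, g i • v i = 0 := hg
    have h2 := h g h1
    simpa [e, Fintype.linearCombination_apply] using h2
  rw [← LinearMap.range_dualMap_eq_dualAnnihilator_ker] at he
  obtain ⟨l, hl⟩ := he
  obtain ⟨z, hz⟩ := exists_sympl_eq (p := 2) (n := n) l
  refine ⟨z, fun i => ?_⟩
  have h1 := LinearMap.congr_fun hl (Pi.single i 1)
  simpa [f, e, ← hz] using h1

theorem exists_sympl_map_of_sympl_eq_one {μ ν ν' : PhaseSpace 2 n}
    (h : sympl μ ν = sympl μ ν') (h1 : sympl ν ν' = 1) :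
    ∃ F : PhaseSpace 2 n → PhaseSpace 2 n, (∀ x y, sympl (F x) (F y) = sympl x y) ∧
      F μ = μ ∧ F ν = ν' := by
  refine ⟨transvec (ν + ν'), sympl_transvec _, ?_, ?_⟩
  · rw [transvec, sympl_add_right, h, CharTwo.add_self_eq_zero, zero_smul, add_zero]
  · rw [transvec, sympl_add_right, sympl_self, h1, zero_add, one_smul, ← add_assoc,
      phaseSpace_add_self, zero_add]

/-- Witt's theorem for the extension of a pair by one vector: at most two transvections that fix
`μ` are needed. -/
theorem exists_sympl_map {μ ν ν' : PhaseSpace 2 n} (hν : ν ≠ 0) (hν' : ν' ≠ 0) (hμν : μ ≠ ν)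
    (hμν' : μ ≠ ν') (h : sympl μ ν = sympl μ ν') :
    ∃ F : PhaseSpace 2 n → PhaseSpace 2 n, (∀ x y, sympl (F x) (F y) = sympl x y) ∧
      F μ = μ ∧ F ν = ν' := by
  rcases zmod_two_eq_zero_or_one (sympl ν ν') with h0 | h1
  · -- `ν` is moved to `ν'` through an intermediate vector `z`
    obtain ⟨z, hz⟩ := exists_forall_sympl_eq ![μ, ν, ν'] ![sympl μ ν, 1, 1] (by
      intro g hg
      rw [Fin.sum_univ_three] at hg ⊢
      change g 0 • μ + g 1 • ν + g 2 • ν' = 0 at hg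
      change g 0 * sympl μ ν + g 1 * 1 + g 2 * 1 = 0
      have hadd : ∀ x y : PhaseSpace 2 n, x + y = 0 → x = y := fun x y hxy => by
        rw [← add_zero x, ← phaseSpace_add_self y, ← add_assoc, hxy, zero_add]
      have h2 : (1 + 1 : ZMod 2) = 0 := CharTwo.add_self_eq_zero 1
      -- the possible linear relations are `μ = 0`, `ν = ν'` and `μ = ν + ν'`
      rcases zmod_two_eq_zero_or_one (g 0) with g0 | g0 <;>
        rcases zmod_two_eq_zero_or_one (g 1) with g1 | g1 <;>
        rcases zmod_two_eq_zero_or_one (g 2) with g2 | g2 <;>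
        simp only [g0, g1, g2, zero_smul, one_smul, zero_add, add_zero, zero_mul, one_mul,
          h2] at hg ⊢
      · exact absurd hg hν'
      · exact absurd hg hν
      · rw [hg, sympl_comm, sympl_zero_right]
      · exact absurd (hadd _ _ hg) hμν'
      · exact absurd (hadd _ _ hg) hμν
      · rw [add_assoc] at hg
        rw [add_assoc, h2, add_zero, hadd _ _ hg, sympl_add_left, sympl_self, sympl_comm, h0,
          zero_add])
    have hz0 : sympl μ z = sympl μ ν := hz 0
    have hz1 : sympl ν z = 1 := hz 1
    have hz2 : sympl ν' z = 1 := hz 2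
    obtain ⟨F, hF, hF1, hF2⟩ := exists_sympl_map_of_sympl_eq_one hz0.symm hz1
    obtain ⟨E, hE, hE1, hE2⟩ := exists_sympl_map_of_sympl_eq_one (hz0.trans h)
      ((sympl_comm _ _).trans hz2)
    exact ⟨E ∘ F, fun x y => (hE _ _).trans (hF _ _), by simp [hF1, hE1], by simp [hF2, hE2]⟩
  · exact exists_sympl_map_of_sympl_eq_one h h1

theorem isGroupDesign_three_cliffordGroup : IsGroupDesign 3 (cliffordGroup 2 n) := by
  refine isGroupDesign_three le_rfl
    (fun κ => (implements_displacementUnitary κ).mem_cliffordGroup)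
    fun μ ν μ' ν' h1 h2 h3 h1' h2' h3' h => ?_
  obtain ⟨F, hF, hF0, hFμ⟩ := exists_sympl_map (μ := 0) h1 h1' h1.symm h1'.symm
    (by rw [sympl_comm, sympl_zero_right, sympl_comm, sympl_zero_right])
  have hinj := injective_of_sympl hF
  obtain ⟨E, hE, hEμ, hEν⟩ := exists_sympl_map (μ := μ') (ν := F ν) (ν' := ν')
    (by rw [← hF0]; exact hinj.ne h2) h2' (by rw [← hFμ]; exact hinj.ne h3) h3'
    (by rw [← hFμ, hF, h, hFμ])
  obtain ⟨U, hU⟩ := exists_implements (F := E ∘ F) fun x y => (hE _ _).trans (hF _ _)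
  exact ⟨U, hU.mem_cliffordGroup, _, hU, by simp [hFμ, hEμ], by simp [hEν]⟩

end Transvection

end CliffordDesign

end

open CliffordDesign in
theorem theorem1 (n : ℕ) (hn : 1 ≤ n) :
    -- the multiqubit Clifford group
    (IsGroupDesign 3 (cliffordGroup 2 n) ∧ ¬ IsGroupDesign 4 (cliffordGroup 2 n)) ∧
    -- the Clifford group in odd prime power dimension
    (∀ (p : ℕ) [Fact p.Prime], p ≠ 2 →
      IsGroupDesign 2 (cliffordGroup p n) ∧ ¬ IsGroupDesign 3 (cliffordGroup p n)) ∧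
    -- the restricted Clifford group in prime power dimension
    (∀ (p : ℕ) [Fact p.Prime] (K : Type*) [Field K] [Algebra (ZMod p) K]
      (φ : PhaseSpace p n ≃ₗ[ZMod p] (Fin 2 → K)), IsSymplecticIdentification φ →
      IsGroupDesign 2 (restrictedCliffordGroup φ) ∧
        (IsGroupDesign 3 (restrictedCliffordGroup φ) ↔ p ^ n = 2)) := by
  refine ⟨⟨isGroupDesign_three_cliffordGroup, not_isGroupDesign_four hn le_rfl⟩,
    fun p _ hp => ⟨isGroupDesign_two_cliffordGroup hn, not_isGroupDesign_three_of_odd hn hp⟩,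
    fun p hp K _ _ φ hφ => ⟨isGroupDesign_two_restrictedCliffordGroup hφ, fun h => ?_, fun h => ?_⟩⟩
  · by_contra hq
    have h2 : 2 ≤ p ^ n := hp.out.two_le.trans (Nat.le_self_pow (by omega) p)
    exact not_isGroupDesign_three_restrictedCliffordGroup hn φ (by omega) h
  · obtain ⟨rfl, rfl⟩ := (Nat.Prime.pow_eq_iff Nat.prime_two).1 h
    exact isGroupDesign_three_restrictedCliffordGroup hφ
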